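/- Let $k$ be a field of characteristic zero. All groups $G,H,\dots$ are finite. **Setting.** A section of a group $X$ is a pair $(T,S)$ of subgroups with $S\trianglelefteq T\le X$. A morphism $f:A\to B$ of finite $X$-sets is *Galois* if, whenever $f(a)=f(a')$, there is an automorphism $\phi$ of the $X$-set $A$ with $f\circ\phi=f$ and $\phi(a)=a'$. The slice Burnside ring of $X$ is the quotient of the free abelian group on isomorphism classes of morphisms of finite $X$-sets by the relations $[f_1\sqcup f_2:A_1\sqcup A_2\to B]-[f_1:A_1\to f_1(A_1)]-[f_2:A_2\to f_2(A_2)]$, and the section Burnside ring $\Gamma(X)$ is its subring generated by the classes of Galois morphisms. Put $\Gamma(G,H)=\Gamma(G\times H)$. For a section $(T,S)$ of $G\times H$ let $\left[\frac{G\times H}{S\trianglelefteq T}\right]\in\Gamma(G,H)$ be the class of the projection $(G\times H)/S\to(G\times H)/T$. Regarding $G\times H$-sets as $(G,H)$-bisets, the amalgamated product $(f,f')\mapsto f\times_H f'$ of morphisms induces a bilinear product $k\Gamma(G,H)\times k\Gamma(H,J)\to k\Gamma(G,J)$, where $k\Gamma(G,H)=k\otimes_{\mathbb Z}\Gamma(G,H)$;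 write $E_G=k\Gamma(G,G)$. Taking opposite bisets induces a $k$-linear map $k\Gamma(G,H)\to k\Gamma(H,G)$, $a\mapsto a^{\mathrm{op}}$. For $U\le G\times H$ let $p_1(U)\le G$, $p_2(U)\le H$ be its projections, $k_1(U)=\{g\mid(g,1)\in U\}$ and $k_2(U)=\{h\mid(1,h)\in U\}$. For a section $(T,S)$ of $G\times H$ put $l(T,S)=(p_1(T),k_1(T),p_1(S),k_1(S))$ and $r(T,S)=(p_2(T),k_2(T),p_2(S),k_2(S))$. Let $\mathcal G_G$ be the set of pairs $(K,P)$ of normal subgroups of $G$ with $[K,P]=1$. Pairs $(K,P)\in\mathcal G_G$ and $(L,Q)\in\mathcal G_H$ are *linked* if some section $(T,S)$ of $G\times H$ has $l(T,S)=(G,K,P,1)$ and $r(T,S)=(H,L,Q,1)$. For $(K,P)\in\mathcal G_G$ put $$e_{(K,P)}=\frac1{|G:P|}\left[\frac{G\times G}{\Delta(P)\trianglelefteq\Delta_K(G)}\right]\in E_G,\qquad \Delta_K(G)=\{(g,h)\mid h^{-1}g\in K\},\quad \Delta(P)=\{(x,x)\mid x\in P\}.$$ The triple $(P,G/K,i_P)$,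 with $G/K$ acting on $P$ by conjugation and $i_P:P\to G/K$ the restriction of the natural map, is a crossed module. For a crossed module $(A,G',\partial)$, $\mathrm{Aut}(A,G',\partial)$ is the group of pairs $(\alpha,\beta)\in\mathrm{Aut}(A)\times\mathrm{Aut}(G')$ with $\partial\alpha=\beta\partial$ and $\alpha({}^ga)={}^{\beta(g)}\alpha(a)$; $\mathrm{Out}(A,G',\partial)$ is its quotient by the normal subgroup of the pairs ($a\mapsto{}^ga$, conjugation by $g$), $g\in G'$. **Theorem.** Let $(K,P)\in\mathcal G_G$ and $(L,Q)\in\mathcal G_H$ be linked. Let $$\Gamma_{(G,K,P)}=\left\{\tfrac1{|G:P|}\left[\tfrac{G\times G}{S\trianglelefteq T}\right]\;\middle|\; l(T,S)=(G,K,P,1)=r(T,S)\right\}\subseteq E_G,$$ let $\Gamma_{(H,L,Q)}\subseteq E_H$ be defined in the same way, and let $${}_{(G,K,P)}\Gamma_{(H,L,Q)}=\left\{\left[\tfrac{G\times H}{U\trianglelefteq V}\right]\;\middle|\; l(V,U)=(G,K,P,1),\ r(V,U)=(H,L,Q,1)\right\}\subseteq k\Gamma(G,H).$$ 1. $\Gamma_{(G,K,P)}$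 is a finite group under the product of $E_G$, with identity $e_{(K,P)}$ and inverses given by $a\mapsto a^{\mathrm{op}}$; likewise for $\Gamma_{(H,L,Q)}$. 2. Under the products above, ${}_{(G,K,P)}\Gamma_{(H,L,Q)}$ is a non-empty $(\Gamma_{(G,K,P)},\Gamma_{(H,L,Q)})$-biset that is transitive and free on the left and on the right. 3. For each $\gamma\in{}_{(G,K,P)}\Gamma_{(H,L,Q)}$ there is a unique group isomorphism $\varphi:\Gamma_{(H,L,Q)}\to\Gamma_{(G,K,P)}$ with $\varphi(b)\gamma=\gamma b$ for all $b\in\Gamma_{(H,L,Q)}$. 4. The functor $k[{}_{(G,K,P)}\Gamma_{(H,L,Q)}]\otimes_{k\Gamma_{(H,L,Q)}}-$ from left $k\Gamma_{(H,L,Q)}$-modules to left $k\Gamma_{(G,K,P)}$-modules is an equivalence of categories; it preserves and reflects finite generation, it maps simple modules to simple modules, and it induces a bijection $\mathrm{Irr}(k\Gamma_{(H,L,Q)})\to\mathrm{Irr}(k\Gamma_{(G,K,P)})$ of isomorphism classes of simple modules. 5. $\Gamma_{(G,K,P)}\cong\mathrm{Out}(P,G/K,i_P)$ as groups. -/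

import Mathlib

open scoped TensorProduct

universe u v w

noncomputable section

namespace SectionBiset

/-! ### Morphisms of finite `G`-sets and the section Burnside group -/

/-- An object of the category of morphisms of finite `G`-sets: an equivariant map `map : X → Y`. -/
structure FinMor (G : Type u) [Group G] where
  X : Type u
  Y : Type u
  [finX : Finite X]
  [finY : Finite Y]
  [actX : MulAction G X]
  [actY : MulAction G Y]
  map : X →[G] Y

attribute [instance] FinMor.finX FinMor.finY FinMor.actX FinMor.actY

namespace FinMor

variable {G : Type u} [Group G]

/-- `f` and `f'` are isomorphic: there are bijective equivariant `α`, `β` with `f' ∘ α = β ∘ f`. -/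
def Iso (f f' : FinMor G) : Prop :=
  ∃ (α : f.X ≃ f'.X) (β : f.Y ≃ f'.Y), (∀ (g : G) x, α (g • x) = g • α x) ∧
    (∀ (g : G) y, β (g • y) = g • β y) ∧ ∀ x, f'.map (α x) = β (f.map x)

theorem Iso.refl (f : FinMor G) : f.Iso f :=
  ⟨Equiv.refl _, Equiv.refl _, fun _ _ => rfl, fun _ _ => rfl, fun _ => rfl⟩

theorem Iso.symm {f f' : FinMor G} : f.Iso f' → f'.Iso f := by
  rintro ⟨α, β, hα, hβ, h⟩
  refine ⟨α.symm, β.symm, fun g x => ?_, fun g x => ?_, fun x => ?_⟩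
  · rw [Equiv.symm_apply_eq, hα, Equiv.apply_symm_apply]
  · rw [Equiv.symm_apply_eq, hβ, Equiv.apply_symm_apply]
  · rw [Equiv.eq_symm_apply, ← h, Equiv.apply_symm_apply]

theorem Iso.trans {f f' f'' : FinMor G} : f.Iso f' → f'.Iso f'' → f.Iso f'' := by
  rintro ⟨α, β, hα, hβ, h⟩ ⟨α', β', hα', hβ', h'⟩
  refine ⟨α.trans α', β.trans β', fun g x => ?_, fun g x => ?_, fun x => ?_⟩
  · simp [hα, hα']
  · simp [hβ, hβ']
  · simp [h, h']

instance setoid (G : Type u) [Group G] : Setoid (FinMor G) :=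
  ⟨Iso, Iso.refl, Iso.symm, Iso.trans⟩

/-- A Galois morphism: two points with the same image are related by an automorphism `φ` of the
`G`-set `X` with `f ∘ φ = f`. -/
def IsGalois (f : FinMor G) : Prop :=
  ∀ x x' : f.X, f.map x = f.map x' →
    ∃ φ : f.X ≃ f.X, (∀ (g : G) z, φ (g • z) = g • φ z) ∧ (∀ z, f.map (φ z) = f.map z) ∧ φ x = x'

/-- The image of an equivariant map, as a sub-`G`-set. -/
def image {X Y : Type u} [MulAction G X] [MulAction G Y] (f : X →[G] Y) : SubMulAction G Y where
  carrier := Set.range f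
  smul_mem' := by
    rintro g _ ⟨x, rfl⟩
    exact ⟨g • x, map_smul f g x⟩

/-- The morphism `f : X → f(X)`. -/
def ontoImage {X Y : Type u} [Finite X] [Finite Y] [MulAction G X] [MulAction G Y]
    (f : X →[G] Y) : FinMor G where
  X := X
  Y := image f
  map :=
    { toFun := fun x => ⟨f x, x, rfl⟩
      map_smul' := fun g x => Subtype.ext (map_smul f g x) }

/-- The morphism `f₁ ⊔ f₂ : X₁ ⊔ X₂ → Y`. -/
def glue {X₁ X₂ Y : Type u} [Finite X₁] [Finite X₂] [Finite Y] [MulAction G X₁] [MulAction G X₂]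
    [MulAction G Y] (f₁ : X₁ →[G] Y) (f₂ : X₂ →[G] Y) : FinMor G where
  X := X₁ ⊕ X₂
  Y := Y
  map :=
    { toFun := Sum.elim f₁ f₂
      map_smul' := by rintro g (x | x) <;> simp }

end FinMor

/-- Isomorphism classes of morphisms of finite `G`-sets. -/
abbrev MorClass (G : Type u) [Group G] : Type (u + 1) := Quotient (FinMor.setoid G)

/-- The defining relations
`[f₁ ⊔ f₂ : X₁ ⊔ X₂ → Y] - [f₁ : X₁ → f₁(X₁)] - [f₂ : X₂ → f₂(X₂)]`. -/
def sliceRelations (G : Type u) [Group G] : Set (FreeAbelianGroup (MorClass G)) :=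
  {r | ∃ (X₁ X₂ Y : Type u) (_ : Finite X₁) (_ : Finite X₂) (_ : Finite Y) (_ : MulAction G X₁)
    (_ : MulAction G X₂) (_ : MulAction G Y) (f₁ : X₁ →[G] Y) (f₂ : X₂ →[G] Y),
    r = FreeAbelianGroup.of ⟦FinMor.glue f₁ f₂⟧ - FreeAbelianGroup.of ⟦FinMor.ontoImage f₁⟧
      - FreeAbelianGroup.of ⟦FinMor.ontoImage f₂⟧}

/-- The (additive group of the) slice Burnside ring of `G`. -/
abbrev SliceBurnside (G : Type u) [Group G] : Type (u + 1) :=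
  FreeAbelianGroup (MorClass G) ⧸ AddSubgroup.closure (sliceRelations G)

/-- The class `[f]` of a morphism in the slice Burnside ring. -/
def sliceClass {G : Type u} [Group G] (f : FinMor G) : SliceBurnside G :=
  QuotientAddGroup.mk (FreeAbelianGroup.of ⟦f⟧)

/-- The (additive group of the) section Burnside ring `Γ(G)`: the part of the slice Burnside ring
generated by the classes of Galois morphisms.  (The identity map of a point is Galois and products
of Galois morphisms are Galois, so the additive span is the subring they generate.) -/
def sectionBurnside (G : Type u) [Group G] : AddSubgroup (SliceBurnside G) :=
  AddSubgroup.closure {a | ∃ f : FinMor G, f.IsGalois ∧ a = sliceClass f}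

section SliceLemmas

variable {G : Type u} [Group G]

theorem sliceClass_eq_of_iso {f f' : FinMor G} (h : f.Iso f') : sliceClass f = sliceClass f' := by
  have : (⟦f⟧ : MorClass G) = ⟦f'⟧ := Quotient.sound h
  simp only [sliceClass, this]

theorem sliceClass_glue {X₁ X₂ Y : Type u} [h₁ : Finite X₁] [h₂ : Finite X₂] [h : Finite Y]
    [i₁ : MulAction G X₁] [i₂ : MulAction G X₂] [i : MulAction G Y]
    (f₁ : X₁ →[G] Y) (f₂ : X₂ →[G] Y) :
    sliceClass (FinMor.glue f₁ f₂) =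
      sliceClass (FinMor.ontoImage f₁) + sliceClass (FinMor.ontoImage f₂) := by
  have hr := AddSubgroup.subset_closure (k := sliceRelations G)
    ⟨X₁, X₂, Y, h₁, h₂, h, i₁, i₂, i, f₁, f₂, rfl⟩
  have h0 := (QuotientAddGroup.eq_zero_iff _).2 hr
  have h1 : sliceClass (FinMor.glue f₁ f₂) - sliceClass (FinMor.ontoImage f₁)
      - sliceClass (FinMor.ontoImage f₂) = 0 := h0
  rw [sub_sub, sub_eq_zero] at h1
  exact h1

theorem ontoImage_iso {f : FinMor G} {X Y : Type u} [Finite X] [Finite Y] [MulAction G X]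
    [MulAction G Y] (h : X →[G] Y) (α : f.X ≃ X) (j : f.Y → Y) (hj : Function.Injective j)
    (hα : ∀ (g : G) x, α (g • x) = g • α x) (hjg : ∀ (g : G) y, j (g • y) = g • j y)
    (hc : ∀ x, h (α x) = j (f.map x)) :
    (FinMor.ontoImage f.map).Iso (FinMor.ontoImage h) := by
  refine ⟨α, Equiv.ofBijective (fun y => ⟨j y.1, ?_⟩) ⟨?_, ?_⟩, hα, ?_, ?_⟩
  · obtain ⟨x, hx⟩ := y.2
    exact ⟨α x, by rw [hc, hx]⟩
  · intro y y' hy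
    exact Subtype.ext (hj (congrArg Subtype.val hy))
  · rintro ⟨_, x, rfl⟩
    refine ⟨⟨f.map (α.symm x), _, rfl⟩, Subtype.ext ?_⟩
    exact (hc _).symm.trans (congrArg h (α.apply_symm_apply x))
  · intro g y
    exact Subtype.ext (hjg g y.1)
  · intro x
    exact Subtype.ext (hc x)

theorem sliceClass_of_isEmpty (f : FinMor G) (h : IsEmpty f.Y) : sliceClass f = 0 := by
  have iso : ∀ f' : FinMor G, IsEmpty f'.Y → f'.Iso f := fun f' h' => by
    have hX : IsEmpty f.X := ⟨fun x => h.elim (f.map x)⟩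
    have hX' : IsEmpty f'.X := ⟨fun x => h'.elim (f'.map x)⟩
    exact ⟨Equiv.equivOfIsEmpty _ _, Equiv.equivOfIsEmpty _ _, fun _ x => hX'.elim x,
      fun _ y => h'.elim y, fun x => hX'.elim x⟩
  have hg := sliceClass_glue f.map f.map
  have hY : IsEmpty (FinMor.ontoImage f.map).Y := ⟨fun y => h.elim y.1⟩
  rw [sliceClass_eq_of_iso (iso _ hY), sliceClass_eq_of_iso (iso (FinMor.glue f.map f.map) h)] at hg
  simpa using hg

theorem sliceClass_ontoImage (f : FinMor G) :
    sliceClass (FinMor.ontoImage f.map) = sliceClass f := by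
  let act : MulAction G PEmpty.{u + 1} :=
    { smul := fun _ x => x
      one_smul := fun x => x.elim
      mul_smul := fun _ _ x => x.elim }
  let e : PEmpty.{u + 1} →[G] f.Y := { toFun := fun x => x.elim, map_smul' := fun _ x => x.elim }
  have h := sliceClass_glue f.map e
  have hY : IsEmpty (FinMor.ontoImage e).Y := ⟨fun y => by obtain ⟨_, x, _⟩ := y; exact x.elim⟩
  rw [sliceClass_of_isEmpty _ hY, add_zero] at h
  rw [← h]
  refine sliceClass_eq_of_iso ⟨Equiv.sumEmpty f.X PEmpty, Equiv.refl _, ?_, fun _ _ => rfl, ?_⟩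
  · rintro g (x | x)
    · rfl
    · exact x.elim
  · rintro (x | x)
    · rfl
    · exact x.elim

/-- Additivity of classes along a decomposition of the source. -/
theorem sliceClass_add {F F₁ F₂ : FinMor G} (i₁ : F₁.X → F.X) (i₂ : F₂.X → F.X)
    (j₁ : F₁.Y → F.Y) (j₂ : F₂.Y → F.Y)
    (hi₁ : ∀ (g : G) x, i₁ (g • x) = g • i₁ x) (hi₂ : ∀ (g : G) x, i₂ (g • x) = g • i₂ x)
    (hj₁ : ∀ (g : G) y, j₁ (g • y) = g • j₁ y) (hj₂ : ∀ (g : G) y, j₂ (g • y) = g • j₂ y)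
    (inj₁ : Function.Injective j₁) (inj₂ : Function.Injective j₂)
    (c₁ : ∀ x, F.map (i₁ x) = j₁ (F₁.map x)) (c₂ : ∀ x, F.map (i₂ x) = j₂ (F₂.map x))
    (hb : Function.Bijective (Sum.elim i₁ i₂)) :
    sliceClass F = sliceClass F₁ + sliceClass F₂ := by
  let f₁ : F₁.X →[G] F.Y := ⟨fun x => F.map (i₁ x), fun g x => by simp [hi₁]⟩
  let f₂ : F₂.X →[G] F.Y := ⟨fun x => F.map (i₂ x), fun g x => by simp [hi₂]⟩
  have h := sliceClass_glue f₁ f₂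
  have e : (FinMor.glue f₁ f₂).Iso F := by
    refine ⟨Equiv.ofBijective _ hb, Equiv.refl _, ?_, fun _ _ => rfl, ?_⟩
    · rintro g (x | x)
      · exact hi₁ g x
      · exact hi₂ g x
    · rintro (x | x) <;> rfl
  rw [sliceClass_eq_of_iso e] at h
  rw [h, ← sliceClass_ontoImage F₁, ← sliceClass_ontoImage F₂]
  congr 1
  · exact (sliceClass_eq_of_iso (ontoImage_iso f₁ (Equiv.refl _) j₁ inj₁ (fun _ _ => rfl) hj₁ c₁)).symm
  · exact (sliceClass_eq_of_iso (ontoImage_iso f₂ (Equiv.refl _) j₂ inj₂ (fun _ _ => rfl) hj₂ c₂)).symm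

end SliceLemmas

/-! ### Composition and opposites

A `(G, H)`-biset is treated as a left `G × H`-set through `(g, h) • x = g x h⁻¹`. -/

section Amalgam

variable (G H K : Type u) [Group G] [Group H] [Group K]

/-- `(x h, x') ∼ (x, h x')` on the product of a `(G, H)`-biset and an `(H, K)`-biset. -/
def amalgSetoid (X X' : Type u) [MulAction (G × H) X] [MulAction (H × K) X'] :
    Setoid (X × X') where
  r p q := ∃ h : H, q.1 = ((1, h) : G × H) • p.1 ∧ q.2 = ((h, 1) : H × K) • p.2
  iseqv :=
    { refl := fun p => ⟨1, (one_smul (G × H) _).symm, (one_smul (H × K) _).symm⟩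
      symm := by
        rintro ⟨x, x'⟩ ⟨_, _⟩ ⟨h, rfl, rfl⟩
        refine ⟨h⁻¹, ?_, ?_⟩ <;> simp [smul_smul, ← Prod.one_eq_mk]
      trans := by
        rintro ⟨x, x'⟩ ⟨_, _⟩ ⟨_, _⟩ ⟨h, rfl, rfl⟩ ⟨h', rfl, rfl⟩
        exact ⟨h' * h, by simp [smul_smul], by simp [smul_smul]⟩ }

/-- The amalgamated product `X ×_H X'` of bisets. -/
def Amalg (X X' : Type u) [MulAction (G × H) X] [MulAction (H × K) X'] : Type u :=
  Quotient (amalgSetoid G H K X X')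

variable {X X' Y Y' : Type u} [MulAction (G × H) X] [MulAction (H × K) X'] [MulAction (G × H) Y]
  [MulAction (H × K) Y']

variable {G H K} in
/-- A pair of equivariant maps induces a map of amalgamated products. -/
def Amalg.map (a : X → Y) (b : X' → Y') (ha : ∀ (g : G × H) x, a (g • x) = g • a x)
    (hb : ∀ (g : H × K) x, b (g • x) = g • b x) : Amalg G H K X X' → Amalg G H K Y Y' :=
  Quotient.map (sa := amalgSetoid G H K X X') (sb := amalgSetoid G H K Y Y')
    (fun p => (a p.1, b p.2)) (by
      rintro ⟨x, x'⟩ ⟨_, _⟩ ⟨h, rfl, rfl⟩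
      exact ⟨h, ha _ _, hb _ _⟩)

/-- The action `(g, k) [x, x'] = [g x, k x']` of `G × K` on `X ×_H X'`. -/
instance : MulAction (G × K) (Amalg G H K X X') where
  smul g := Quotient.map (sa := amalgSetoid G H K X X') (sb := amalgSetoid G H K X X')
    (fun p => (((g.1, 1) : G × H) • p.1, ((1, g.2) : H × K) • p.2)) (by
      rintro ⟨x, x'⟩ ⟨_, _⟩ ⟨h, rfl, rfl⟩
      exact ⟨h, by simp [smul_smul], by simp [smul_smul]⟩)
  one_smul := by
    rintro ⟨x, x'⟩
    exact congrArg (Quotient.mk (amalgSetoid G H K X X'))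
      (Prod.ext (one_smul (G × H) x) (one_smul (H × K) x'))
  mul_smul := by
    rintro ⟨g, k⟩ ⟨g', k'⟩ ⟨x, x'⟩
    refine congrArg (Quotient.mk (amalgSetoid G H K X X')) (Prod.ext ?_ ?_)
    · change ((g * g', 1) : G × H) • x = ((g, 1) : G × H) • ((g', 1) : G × H) • x
      simp [smul_smul]
    · change ((1, k * k') : H × K) • x' = ((1, k) : H × K) • ((1, k') : H × K) • x'
      simp [smul_smul]

instance [Finite X] [Finite X'] : Finite (Amalg G H K X X') :=
  inferInstanceAs (Finite (Quotient (amalgSetoid G H K X X')))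

variable {G H K}

theorem Amalg.map_smul (a : X → Y) (b : X' → Y') (ha : ∀ (g : G × H) x, a (g • x) = g • a x)
    (hb : ∀ (g : H × K) x, b (g • x) = g • b x) (g : G × K) (p : Amalg G H K X X') :
    Amalg.map a b ha hb (g • p) = g • Amalg.map a b ha hb p := by
  obtain ⟨x, x'⟩ := p
  exact congrArg (Quotient.mk (amalgSetoid G H K Y Y')) (Prod.ext (ha _ _) (hb _ _))

theorem Amalg.map_injective (a : X → Y) (b : X' → Y') (ha : ∀ (g : G × H) x, a (g • x) = g • a x)
    (hb : ∀ (g : H × K) x, b (g • x) = g • b x) (ia : Function.Injective a)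
    (ib : Function.Injective b) : Function.Injective (Amalg.map a b ha hb) := by
  rintro ⟨x, x'⟩ ⟨z, z'⟩ hxz
  obtain ⟨h, h1, h2⟩ := Quotient.exact hxz
  exact Quotient.sound ⟨h, ia (h1.trans (ha _ _).symm), ib (h2.trans (hb _ _).symm)⟩

theorem Amalg.map_surjective (a : X → Y) (b : X' → Y')
    (ha : ∀ (g : G × H) x, a (g • x) = g • a x) (hb : ∀ (g : H × K) x, b (g • x) = g • b x)
    (sa : Function.Surjective a) (sb : Function.Surjective b) :
    Function.Surjective (Amalg.map a b ha hb) := by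
  rintro ⟨y, y'⟩
  obtain ⟨x, rfl⟩ := sa y
  obtain ⟨x', rfl⟩ := sb y'
  exact ⟨Quotient.mk _ (x, x'), rfl⟩

/-- A pair of equivariant bijections induces a bijection of amalgamated products. -/
def Amalg.congr (a : X ≃ Y) (b : X' ≃ Y') (ha : ∀ (g : G × H) x, a (g • x) = g • a x)
    (hb : ∀ (g : H × K) x, b (g • x) = g • b x) : Amalg G H K X X' ≃ Amalg G H K Y Y' :=
  Equiv.ofBijective (Amalg.map a b ha hb) ⟨Amalg.map_injective _ _ _ _ a.injective b.injective,
    Amalg.map_surjective _ _ _ _ a.surjective b.surjective⟩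

end Amalgam

section Composition

variable {G H K : Type u} [Group G] [Group H] [Group K]

/-- The composite `f ×_H f' : X ×_H X' → Y ×_H Y'`. -/
def FinMor.comp (f : FinMor (G × H)) (f' : FinMor (H × K)) : FinMor (G × K) where
  X := Amalg G H K f.X f'.X
  Y := Amalg G H K f.Y f'.Y
  map :=
    { toFun := Amalg.map f.map f'.map (map_smul f.map) (map_smul f'.map)
      map_smul' := Amalg.map_smul _ _ _ _ }

theorem FinMor.comp_iso {f₁ f₂ : FinMor (G × H)} {f₁' f₂' : FinMor (H × K)} (h : f₁.Iso f₂)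
    (h' : f₁'.Iso f₂') : (f₁.comp f₁').Iso (f₂.comp f₂') := by
  obtain ⟨α, β, hα, hβ, h⟩ := h
  obtain ⟨α', β', hα', hβ', h'⟩ := h'
  refine ⟨Amalg.congr α α' hα hα', Amalg.congr β β' hβ hβ',
    Amalg.map_smul _ _ hα hα', Amalg.map_smul _ _ hβ hβ', ?_⟩
  rintro ⟨x, x'⟩
  exact congrArg (Quotient.mk (amalgSetoid G H K f₂.Y f₂'.Y)) (Prod.ext (h _) (h' _))

theorem FinMor.IsGalois.comp {f : FinMor (G × H)} {f' : FinMor (H × K)} (hf : f.IsGalois)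
    (hf' : f'.IsGalois) : (f.comp f').IsGalois := by
  rintro ⟨x, x'⟩ ⟨z, z'⟩ hxz
  obtain ⟨h, h1, h2⟩ := Quotient.exact hxz
  have h1 : f.map z = ((1, h) : G × H) • f.map x := h1
  have h2 : f'.map z' = ((h, 1) : H × K) • f'.map x' := h2
  rw [← map_smul] at h1 h2
  obtain ⟨φ, p1, p2, p3⟩ := hf _ _ h1.symm
  obtain ⟨φ', p1', p2', p3'⟩ := hf' _ _ h2.symm
  refine ⟨Amalg.congr φ φ' p1 p1', Amalg.map_smul _ _ p1 p1', ?_, ?_⟩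
  · rintro ⟨y, y'⟩
    exact congrArg (Quotient.mk (amalgSetoid G H K f.Y f'.Y)) (Prod.ext (p2 _) (p2' _))
  · rw [← p3, ← p3', p1, p1']
    exact Quotient.sound (s := amalgSetoid G H K f.X f'.X) (a := (φ x, φ' x'))
      (b := (((1, h) : G × H) • φ x, ((h, 1) : H × K) • φ' x')) ⟨h, rfl, rfl⟩

theorem sliceClass_glue_comp {X₁ X₂ Y : Type u} [Finite X₁] [Finite X₂] [Finite Y]
    [MulAction (G × H) X₁] [MulAction (G × H) X₂] [MulAction (G × H) Y] (f₁ : X₁ →[G × H] Y)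
    (f₂ : X₂ →[G × H] Y) (f' : FinMor (H × K)) :
    sliceClass ((FinMor.glue f₁ f₂).comp f') =
      sliceClass ((FinMor.ontoImage f₁).comp f') + sliceClass ((FinMor.ontoImage f₂).comp f') := by
  refine sliceClass_add (F := (FinMor.glue f₁ f₂).comp f')
    (F₁ := (FinMor.ontoImage f₁).comp f') (F₂ := (FinMor.ontoImage f₂).comp f')
    (Amalg.map (Y := X₁ ⊕ X₂) (Y' := f'.X) Sum.inl id (fun _ _ => rfl) (fun _ _ => rfl))
    (Amalg.map (Y := X₁ ⊕ X₂) (Y' := f'.X) Sum.inr id (fun _ _ => rfl) (fun _ _ => rfl))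
    (Amalg.map (X := FinMor.image f₁) (Y := Y) (Y' := f'.Y)
      (fun y => y.1) id (fun _ _ => rfl) (fun _ _ => rfl))
    (Amalg.map (X := FinMor.image f₂) (Y := Y) (Y' := f'.Y)
      (fun y => y.1) id (fun _ _ => rfl) (fun _ _ => rfl))
    (Amalg.map_smul _ _ _ _) (Amalg.map_smul _ _ _ _) (Amalg.map_smul _ _ _ _)
    (Amalg.map_smul _ _ _ _)
    (Amalg.map_injective _ _ _ _ Subtype.val_injective Function.injective_id)
    (Amalg.map_injective _ _ _ _ Subtype.val_injective Function.injective_id)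
    ?_ ?_ ⟨?_, ?_⟩
  · rintro ⟨x, x'⟩; rfl
  · rintro ⟨x, x'⟩; rfl
  · rintro (⟨x, x'⟩ | ⟨x, x'⟩) (⟨z, z'⟩ | ⟨z, z'⟩) hxz <;> obtain ⟨h, h1, h2⟩ := Quotient.exact hxz
    · exact congrArg Sum.inl (Quotient.sound ⟨h, Sum.inl_injective h1, h2⟩)
    · exact (Sum.inr_ne_inl h1).elim
    · exact (Sum.inl_ne_inr h1).elim
    · exact congrArg Sum.inr (Quotient.sound ⟨h, Sum.inr_injective h1, h2⟩)
  · rintro ⟨x | x, x'⟩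
    · exact ⟨Sum.inl (Quotient.mk _ (x, x')), rfl⟩
    · exact ⟨Sum.inr (Quotient.mk _ (x, x')), rfl⟩

theorem sliceClass_comp_glue (f : FinMor (G × H)) {X₁ X₂ Y : Type u} [Finite X₁] [Finite X₂]
    [Finite Y] [MulAction (H × K) X₁] [MulAction (H × K) X₂] [MulAction (H × K) Y]
    (f₁ : X₁ →[H × K] Y) (f₂ : X₂ →[H × K] Y) :
    sliceClass (f.comp (FinMor.glue f₁ f₂)) =
      sliceClass (f.comp (FinMor.ontoImage f₁)) + sliceClass (f.comp (FinMor.ontoImage f₂)) := by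
  refine sliceClass_add (F := f.comp (FinMor.glue f₁ f₂))
    (F₁ := f.comp (FinMor.ontoImage f₁)) (F₂ := f.comp (FinMor.ontoImage f₂))
    (Amalg.map (Y' := X₁ ⊕ X₂) (Y := f.X) id Sum.inl (fun _ _ => rfl) (fun _ _ => rfl))
    (Amalg.map (Y' := X₁ ⊕ X₂) (Y := f.X) id Sum.inr (fun _ _ => rfl) (fun _ _ => rfl))
    (Amalg.map (X' := FinMor.image f₁) (Y := f.Y) (Y' := Y)
      id (fun y => y.1) (fun _ _ => rfl) (fun _ _ => rfl))
    (Amalg.map (X' := FinMor.image f₂) (Y := f.Y) (Y' := Y)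
      id (fun y => y.1) (fun _ _ => rfl) (fun _ _ => rfl))
    (Amalg.map_smul _ _ _ _) (Amalg.map_smul _ _ _ _) (Amalg.map_smul _ _ _ _)
    (Amalg.map_smul _ _ _ _)
    (Amalg.map_injective _ _ _ _ Function.injective_id Subtype.val_injective)
    (Amalg.map_injective _ _ _ _ Function.injective_id Subtype.val_injective)
    ?_ ?_ ⟨?_, ?_⟩
  · rintro ⟨x, x'⟩; rfl
  · rintro ⟨x, x'⟩; rfl
  · rintro (⟨x, x'⟩ | ⟨x, x'⟩) (⟨z, z'⟩ | ⟨z, z'⟩) hxz <;> obtain ⟨h, h1, h2⟩ := Quotient.exact hxz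
    · exact congrArg Sum.inl (Quotient.sound ⟨h, h1, Sum.inl_injective h2⟩)
    · exact (Sum.inr_ne_inl h2).elim
    · exact (Sum.inl_ne_inr h2).elim
    · exact congrArg Sum.inr (Quotient.sound ⟨h, h1, Sum.inr_injective h2⟩)
  · rintro ⟨x, x' | x'⟩
    · exact ⟨Sum.inl (Quotient.mk _ (x, x')), rfl⟩
    · exact ⟨Sum.inr (Quotient.mk _ (x, x')), rfl⟩

/-- The class of `f ×_H f'` as a function of the isomorphism classes of `f` and `f'`. -/
def compClass : MorClass (G × H) → MorClass (H × K) → SliceBurnside (G × K) :=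
  Quotient.lift₂ (fun f f' => sliceClass (f.comp f'))
    (fun _ _ _ _ h h' => sliceClass_eq_of_iso (FinMor.comp_iso h h'))

/-- `compClass`, extended additively in the second variable. -/
def compRight (c : MorClass (G × H)) : SliceBurnside (H × K) →+ SliceBurnside (G × K) :=
  QuotientAddGroup.lift _ (FreeAbelianGroup.lift (compClass c)) (by
    rw [AddSubgroup.closure_le]
    rintro _ ⟨X₁, X₂, Y, _, _, _, _, _, _, f₁, f₂, rfl⟩
    obtain ⟨f, rfl⟩ := Quotient.exists_rep c
    rw [SetLike.mem_coe, AddMonoidHom.mem_ker, map_sub, map_sub, FreeAbelianGroup.lift_apply_of,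
      FreeAbelianGroup.lift_apply_of, FreeAbelianGroup.lift_apply_of, sub_sub, sub_eq_zero]
    exact sliceClass_comp_glue f f₁ f₂)

/-- The biadditive composition induced by `([f], [f']) ↦ [f ×_H f']`. -/
def sliceComp : SliceBurnside (G × H) →+ SliceBurnside (H × K) →+ SliceBurnside (G × K) :=
  QuotientAddGroup.lift _ (FreeAbelianGroup.lift compRight) (by
    rw [AddSubgroup.closure_le]
    rintro _ ⟨X₁, X₂, Y, _, _, _, _, _, _, f₁, f₂, rfl⟩
    rw [SetLike.mem_coe, AddMonoidHom.mem_ker, map_sub, map_sub, FreeAbelianGroup.lift_apply_of,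
      FreeAbelianGroup.lift_apply_of, FreeAbelianGroup.lift_apply_of, sub_sub, sub_eq_zero]
    refine QuotientAddGroup.addMonoidHom_ext _ (FreeAbelianGroup.lift_ext _ _ fun d => ?_)
    obtain ⟨f', rfl⟩ := Quotient.exists_rep d
    have key : ∀ f : FinMor (G × H), compRight (K := K) ⟦f⟧ (sliceClass f') =
        sliceClass (f.comp f') := fun f => FreeAbelianGroup.lift_apply_of (compClass ⟦f⟧) ⟦f'⟧
    have h := sliceClass_glue_comp f₁ f₂ f'
    rw [← key, ← key, ← key] at h
    exact h)

theorem sliceComp_sliceClass (f : FinMor (G × H)) (f' : FinMor (H × K)) :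
    sliceComp (sliceClass f) (sliceClass f') = sliceClass (f.comp f') := by
  have h : sliceComp (K := K) (sliceClass f) = compRight ⟦f⟧ :=
    FreeAbelianGroup.lift_apply_of compRight ⟦f⟧
  rw [h]
  exact FreeAbelianGroup.lift_apply_of (compClass ⟦f⟧) ⟦f'⟧

theorem sliceComp_mem {a : SliceBurnside (G × H)} {b : SliceBurnside (H × K)}
    (ha : a ∈ sectionBurnside (G × H)) (hb : b ∈ sectionBurnside (H × K)) :
    sliceComp a b ∈ sectionBurnside (G × K) := by
  have h1 : sectionBurnside (G × H) ≤ (sectionBurnside (G × K)).comap (sliceComp.flip b) := by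
    rw [sectionBurnside, AddSubgroup.closure_le]
    rintro _ ⟨f, hf, rfl⟩
    have h2 : sectionBurnside (H × K) ≤
        (sectionBurnside (G × K)).comap (sliceComp (sliceClass f)) := by
      rw [sectionBurnside, AddSubgroup.closure_le]
      rintro _ ⟨f', hf', rfl⟩
      exact AddSubgroup.subset_closure ⟨f.comp f', hf.comp hf', sliceComp_sliceClass f f'⟩
    exact h2 hb
  exact h1 ha

variable (G H) in
/-- `Γ(G, H)`, the section Burnside group of `G × H`. -/
abbrev SecHom : Type (u + 1) := sectionBurnside (G × H)

/-- The composition product `Γ(G, H) × Γ(H, K) → Γ(G, K)`. -/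
def secComp : SecHom G H →ₗ[ℤ] SecHom H K →ₗ[ℤ] SecHom G K :=
  LinearMap.mk₂ ℤ (fun a b => ⟨sliceComp a.1 b.1, sliceComp_mem a.2 b.2⟩)
    (fun a a' b => Subtype.ext (DFunLike.congr_fun (map_add sliceComp a.1 a'.1) b.1))
    (fun n a b => Subtype.ext (DFunLike.congr_fun (map_zsmul sliceComp n a.1) b.1))
    (fun a b b' => Subtype.ext (map_add (sliceComp a.1) b.1 b'.1))
    (fun n a b => Subtype.ext (map_zsmul (sliceComp a.1) n b.1))

end Composition

section Opposite

variable {G H : Type u} [Group G] [Group H]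

/-- `X` with the `H × G`-action obtained by swapping the factors: the opposite biset. -/
def Opp (G H X : Type u) [Group G] [Group H] [MulAction (G × H) X] : Type u := X

instance (X : Type u) [MulAction (G × H) X] : MulAction (H × G) (Opp G H X) where
  smul g x := (((g.2, g.1) : G × H) • (show X from x) : X)
  one_smul x := one_smul (G × H) (show X from x)
  mul_smul g g' x := mul_smul ((g.2, g.1) : G × H) (g'.2, g'.1) (show X from x)

instance (X : Type u) [MulAction (G × H) X] [h : Finite X] : Finite (Opp G H X) := h

/-- The opposite morphism `f^op : X^op → Y^op`. -/
def FinMor.opp (f : FinMor (G × H)) : FinMor (H × G) where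
  X := Opp G H f.X
  Y := Opp G H f.Y
  map :=
    { toFun := f.map
      map_smul' := fun g x => map_smul f.map ((g.2, g.1) : G × H) (show f.X from x) }

theorem FinMor.opp_iso {f f' : FinMor (G × H)} : f.Iso f' → f.opp.Iso f'.opp := by
  rintro ⟨α, β, hα, hβ, h⟩
  exact ⟨α, β, fun g x => hα (g.2, g.1) x, fun g y => hβ (g.2, g.1) y, h⟩

theorem FinMor.IsGalois.opp {f : FinMor (G × H)} (hf : f.IsGalois) : f.opp.IsGalois := by
  intro x x' hx
  obtain ⟨φ, h1, h2, h3⟩ := hf x x' hx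
  refine ⟨φ, fun g z => ?_, h2, h3⟩
  exact h1 (g.2, g.1) z

/-- The additive map induced by `[f] ↦ [f^op]`. -/
def sliceOpp : SliceBurnside (G × H) →+ SliceBurnside (H × G) :=
  QuotientAddGroup.lift _ (FreeAbelianGroup.lift (Quotient.lift (fun f => sliceClass f.opp)
    fun _ _ h => sliceClass_eq_of_iso (FinMor.opp_iso h))) (by
    rw [AddSubgroup.closure_le]
    rintro _ ⟨X₁, X₂, Y, _, _, _, _, _, _, f₁, f₂, rfl⟩
    rw [SetLike.mem_coe, AddMonoidHom.mem_ker, map_sub, map_sub, FreeAbelianGroup.lift_apply_of,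
      FreeAbelianGroup.lift_apply_of, FreeAbelianGroup.lift_apply_of, sub_sub, sub_eq_zero]
    refine sliceClass_add (F := (FinMor.glue f₁ f₂).opp) (F₁ := (FinMor.ontoImage f₁).opp)
      (F₂ := (FinMor.ontoImage f₂).opp) (Sum.inl : X₁ → X₁ ⊕ X₂) (Sum.inr : X₂ → X₁ ⊕ X₂)
      (fun y : FinMor.image f₁ => y.1) (fun y : FinMor.image f₂ => y.1) (fun _ _ => rfl)
      (fun _ _ => rfl) (fun _ _ => rfl) (fun _ _ => rfl) Subtype.val_injective
      Subtype.val_injective (fun _ => rfl) (fun _ => rfl) ?_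
    have h : (Sum.elim Sum.inl Sum.inr : X₁ ⊕ X₂ → X₁ ⊕ X₂) = id := Sum.elim_inl_inr
    exact h ▸ Function.bijective_id)

theorem sliceOpp_mem {a : SliceBurnside (G × H)} (ha : a ∈ sectionBurnside (G × H)) :
    sliceOpp a ∈ sectionBurnside (H × G) := by
  have h1 : sectionBurnside (G × H) ≤ (sectionBurnside (H × G)).comap sliceOpp := by
    rw [sectionBurnside, AddSubgroup.closure_le]
    rintro _ ⟨f, hf, rfl⟩
    exact AddSubgroup.subset_closure ⟨f.opp, hf.opp,
      FreeAbelianGroup.lift_apply_of (β := SliceBurnside (H × G)) _ (⟦f⟧ : MorClass (G × H))⟩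
  exact h1 ha

/-- The map `Γ(G, H) → Γ(H, G)` induced by taking opposites. -/
def secOpp : SecHom G H →+ SecHom H G :=
  AddMonoidHom.mk' (fun a => ⟨sliceOpp a.1, sliceOpp_mem a.2⟩)
    (fun a a' => Subtype.ext (map_add sliceOpp a.1 a'.1))

end Opposite

section Coefficients

variable (k : Type w) [Field k] (G H K : Type u) [Group G] [Group H] [Group K]

/-- `kΓ(G, H) = k ⊗ Γ(G, H)`; for `H = G` this is the algebra `E_G`. -/
abbrev LinHom : Type (max w (u + 1)) := k ⊗[ℤ] SecHom G H

variable {k G H K}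

/-- The product `kΓ(G, H) × kΓ(H, K) → kΓ(G, K)`, the bilinear extension of the composition
product: `(c ⊗ a) (d ⊗ b) = (c d) ⊗ (a ×_H b)`. -/
def linComp (a : LinHom k G H) (b : LinHom k H K) : LinHom k G K :=
  TensorProduct.map₂ (LinearMap.mul ℤ k) secComp a b

/-- The linear extension of taking opposites. -/
def linOpp (a : LinHom k G H) : LinHom k H G :=
  secOpp.toIntLinearMap.lTensor k a

end Coefficients

/-! ### Sections of direct products and their invariants -/

/-- A section `(T, S)` of `G`: subgroups `S ⊴ T ≤ G`. -/
structure GroupSection (G : Type u) [Group G] where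
  T : Subgroup G
  S : Subgroup G
  le : S ≤ T
  normal : (S.subgroupOf T).Normal

namespace GroupSection

variable {G H : Type u} [Group G] [Group H]

theorem conj_mem (s : GroupSection G) {t x : G} (ht : t ∈ s.T) (hx : x ∈ s.S) :
    t * x * t⁻¹ ∈ s.S := by
  have h := s.normal.conj_mem ⟨x, s.le hx⟩ (Subgroup.mem_subgroupOf.2 hx) ⟨t, ht⟩
  exact Subgroup.mem_subgroupOf.1 h

/-- The projection `G/S → G/T` attached to a section. -/
def proj [Finite G] (s : GroupSection G) : FinMor G where
  X := G ⧸ s.S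
  Y := G ⧸ s.T
  map :=
    { toFun := Subgroup.quotientMapOfLE s.le
      map_smul' := by
        rintro g ⟨x⟩
        rfl }

theorem proj_isGalois [Finite G] (s : GroupSection G) : s.proj.IsGalois := by
  rintro ⟨x⟩ ⟨x'⟩ hx
  have ht : x⁻¹ * x' ∈ s.T := QuotientGroup.eq.1 hx
  have wd : ∀ t ∈ s.T, ∀ a b : G, (QuotientGroup.leftRel s.S) a b →
      (QuotientGroup.leftRel s.S) (a * t) (b * t) := by
    intro t ht a b hab
    rw [QuotientGroup.leftRel_apply] at hab ⊢
    have := s.conj_mem (s.T.inv_mem ht) hab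
    simpa [mul_assoc] using this
  let φ : ∀ t ∈ s.T, G ⧸ s.S → G ⧸ s.S := fun t ht => Quotient.map (fun a => a * t) (wd t ht)
  have inv : ∀ t (ht : t ∈ s.T) (ht' : t⁻¹ ∈ s.T) z, φ t⁻¹ ht' (φ t ht z) = z := by
    rintro t ht ht' ⟨z⟩
    exact congrArg (QuotientGroup.mk (s := s.S)) (mul_inv_cancel_right z t)
  have inv' : ∀ t (ht : t ∈ s.T) (ht' : t⁻¹ ∈ s.T) z, φ t ht (φ t⁻¹ ht' z) = z := by
    rintro t ht ht' ⟨z⟩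
    exact congrArg (QuotientGroup.mk (s := s.S)) (inv_mul_cancel_right z t)
  refine ⟨⟨φ _ ht, φ _ (s.T.inv_mem ht), inv _ ht (s.T.inv_mem ht),
    inv' _ ht (s.T.inv_mem ht)⟩, ?_, ?_, ?_⟩
  · rintro g ⟨z⟩
    exact congrArg (QuotientGroup.mk (s := s.S)) (mul_assoc g z _)
  · rintro ⟨z⟩
    refine QuotientGroup.eq.2 ?_
    simpa [mul_assoc] using s.T.inv_mem ht
  · exact congrArg (QuotientGroup.mk (s := s.S)) (mul_inv_cancel_left x x')

/-- The class of `G/S → G/T` in the section Burnside group. -/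
def cls [Finite G] (s : GroupSection G) : sectionBurnside G :=
  ⟨sliceClass s.proj, AddSubgroup.subset_closure ⟨s.proj, s.proj_isGalois, rfl⟩⟩

/-- The left invariants `(p₁(T), k₁(T), p₁(S), k₁(S))` of a section of `G × H`, where
`p₁(U) = {g | ∃ h, (g, h) ∈ U}` and `k₁(U) = {g | (g, 1) ∈ U}`. -/
def left (s : GroupSection (G × H)) : Subgroup G × Subgroup G × Subgroup G × Subgroup G :=
  (s.T.map (MonoidHom.fst G H), s.T.comap (MonoidHom.inl G H),
    s.S.map (MonoidHom.fst G H), s.S.comap (MonoidHom.inl G H))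

/-- The right invariants `(p₂(T), k₂(T), p₂(S), k₂(S))` of a section of `G × H`, where
`p₂(U) = {h | ∃ g, (g, h) ∈ U}` and `k₂(U) = {h | (1, h) ∈ U}`. -/
def right (s : GroupSection (G × H)) : Subgroup H × Subgroup H × Subgroup H × Subgroup H :=
  (s.T.map (MonoidHom.snd G H), s.T.comap (MonoidHom.inr G H),
    s.S.map (MonoidHom.snd G H), s.S.comap (MonoidHom.inr G H))

end GroupSection

/-- Pairs `(K, P)` of normal subgroups of `G` with `[K, P] = 1`. -/
structure CommPair (G : Type u) [Group G] where
  K : Subgroup G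
  P : Subgroup G
  normK : K.Normal
  normP : P.Normal
  comm : ⁅K, P⁆ = ⊥

attribute [instance] CommPair.normK CommPair.normP

section Invariants

variable {G H : Type u} [Group G] [Group H]

/-- The section `s` of `G × H` has invariants `l(s) = (G, K, P, 1)` and `r(s) = (H, L, Q, 1)`. -/
def HasInvariants (p : CommPair G) (q : CommPair H) (s : GroupSection (G × H)) : Prop :=
  s.left = (⊤, p.K, p.P, ⊥) ∧ s.right = (⊤, q.K, q.P, ⊥)

/-- `(G, K, P, 1)` and `(H, L, Q, 1)` are linked. -/
def Linked (p : CommPair G) (q : CommPair H) : Prop :=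
  ∃ s : GroupSection (G × H), HasInvariants p q s

theorem CommPair.mul_comm_of_mem (p : CommPair G) {x y : G} (hx : x ∈ p.K) (hy : y ∈ p.P) :
    x * y = y * x :=
  commutatorElement_eq_one_iff_mul_comm.1
    ((Subgroup.mem_bot).1 (p.comm ▸ Subgroup.commutator_mem_commutator hx hy))

/-- The section `(Δ_K(G), Δ(P))` of `G × G`, where `Δ_K(G) = {(g, h) | h⁻¹ g ∈ K}` and
`Δ(P) = {(x, x) | x ∈ P}`. -/
def CommPair.diagSection (p : CommPair G) : GroupSection (G × G) where
  T :=
    { carrier := {x | x.2⁻¹ * x.1 ∈ p.K}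
      one_mem' := by simp
      mul_mem' := by
        intro a b ha hb
        have h := p.K.mul_mem (p.normK.conj_mem _ ha b.2⁻¹) hb
        simpa [mul_assoc] using h
      inv_mem' := by
        intro a ha
        have h := p.normK.conj_mem _ (p.K.inv_mem ha) a.2
        simpa [mul_assoc] using h }
  S := p.P.map ((MonoidHom.id G).prod (MonoidHom.id G))
  le := by
    rintro _ ⟨x, _, rfl⟩
    change x⁻¹ * x ∈ p.K
    simp
  normal := by
    refine ⟨?_⟩
    rintro ⟨_, _⟩ hS ⟨⟨g, h⟩, hg⟩
    obtain ⟨x, hx, rfl⟩ := Subgroup.mem_subgroupOf.1 hS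
    have hg : h⁻¹ * g ∈ p.K := hg
    refine Subgroup.mem_subgroupOf.2 ⟨h * x * h⁻¹, p.normP.conj_mem x hx h, ?_⟩
    have hc := p.mul_comm_of_mem hg hx
    have e : h * x * h⁻¹ = g * x * g⁻¹ := by
      rw [mul_inv_eq_iff_eq_mul, mul_assoc, mul_assoc, eq_comm]
      calc g * (x * (g⁻¹ * h)) = h * ((h⁻¹ * g) * x) * (g⁻¹ * h) := by group
        _ = h * x := by rw [hc]; group
    exact Prod.ext e rfl

variable (k : Type w) [Field k] [Finite G] [Finite H]

/-- The idempotent `e_{(K, P)} = |G : P|⁻¹ [(Δ_K(G), Δ(P))]` of `E_G`. -/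
def idem (p : CommPair G) : LinHom k G G :=
  (p.P.index : k)⁻¹ ⊗ₜ[ℤ] p.diagSection.cls

/-- The set `Γ_{(G,K,P)}` of all `|G : P|⁻¹ [T, S]` in `E_G` with `l(T, S) = (G,K,P,1) = r(T, S)`. -/
def Gam (p : CommPair G) : Set (LinHom k G G) :=
  {a | ∃ s : GroupSection (G × G), HasInvariants p p s ∧ a = (p.P.index : k)⁻¹ ⊗ₜ[ℤ] s.cls}

/-- The set `_{(G,K,P)}Γ_{(H,L,Q)}` of all `[V, U]` in `kΓ(G, H)` with `l(V, U) = (G,K,P,1)` and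
`r(V, U) = (H,L,Q,1)`. -/
def GamBi (p : CommPair G) (q : CommPair H) : Set (LinHom k G H) :=
  {a | ∃ s : GroupSection (G × H), HasInvariants p q s ∧ a = (1 : k) ⊗ₜ[ℤ] s.cls}

end Invariants

/-! ### Crossed modules -/

/-- A crossed module `(A, G, ∂)`. -/
structure CrossedModule (A : Type u) (G : Type v) [Group A] [Group G] where
  act : G →* MulAut A
  bd : A →* G
  bd_act : ∀ g a, bd (act g a) = g * bd a * g⁻¹
  act_bd : ∀ a b, act (bd b) a = b * a * b⁻¹

namespace CrossedModule

variable {A : Type u} {G : Type v} [Group A] [Group G] (M : CrossedModule A G)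

/-- The automorphism group of a crossed module, inside `Aut(A) × Aut(G)`. -/
def aut : Subgroup (MulAut A × MulAut G) where
  carrier := {x | (∀ a, M.bd (x.1 a) = x.2 (M.bd a)) ∧
    ∀ g a, x.1 (M.act g a) = M.act (x.2 g) (x.1 a)}
  one_mem' := ⟨fun _ => rfl, fun _ _ => rfl⟩
  mul_mem' := by
    rintro x y ⟨hx, hx'⟩ ⟨hy, hy'⟩
    exact ⟨fun a => by simp [hx, hy], fun g a => by simp [hx', hy']⟩
  inv_mem' := by
    rintro ⟨α, β⟩ ⟨h, h'⟩
    refine ⟨fun a => β.injective ?_, fun g a => α.injective ?_⟩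
    · change β (M.bd (α⁻¹ a)) = β (β⁻¹ (M.bd a))
      rw [← h, MulAut.apply_inv_self, MulAut.apply_inv_self]
    · change α (α⁻¹ (M.act g a)) = α (M.act (β⁻¹ g) (α⁻¹ a))
      rw [h', MulAut.apply_inv_self, MulAut.apply_inv_self, MulAut.apply_inv_self]

/-- The homomorphism `θ : G → Aut(A, G, ∂)` sending `g` to the inner automorphism `(α_g, c_g)`. -/
def innerHom : G →* M.aut where
  toFun g := ⟨(M.act g, MulAut.conj g), fun a => by simp [M.bd_act], fun h a => by
    simp [← MulAut.mul_apply, ← map_mul]⟩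
  map_one' := Subtype.ext (by simp)
  map_mul' g h := Subtype.ext (by simp)

/-- The group of inner automorphisms. -/
def inn : Subgroup M.aut := M.innerHom.range

instance : M.inn.Normal := by
  refine ⟨?_⟩
  rintro _ ⟨g, rfl⟩ x
  refine ⟨x.1.2 g, ?_⟩
  rw [eq_mul_inv_iff_mul_eq]
  refine Subtype.ext (Prod.ext (MulEquiv.ext fun a => ?_) (MulEquiv.ext fun h => ?_))
  · exact (x.2.2 g a).symm
  · simp [innerHom]

/-- The group of outer automorphisms. -/
abbrev Out : Type (max u v) := M.aut ⧸ M.inn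

end CrossedModule

/-- The crossed module `(P, G/K, i_P)`: `G/K` acts on `P` by conjugation and `i_P` is the
restriction of `G → G/K` to `P`. -/
def CommPair.crossed {G : Type u} [Group G] (p : CommPair G) : CrossedModule p.P (G ⧸ p.K) where
  act := QuotientGroup.lift p.K MulAut.conjNormal (by
    intro x hx
    refine MulEquiv.ext fun y => Subtype.ext ?_
    rw [MulAut.conjNormal_apply, p.mul_comm_of_mem hx y.2]
    simp)
  bd := (QuotientGroup.mk' p.K).comp p.P.subtype
  bd_act := by
    rintro ⟨g⟩ a
    change QuotientGroup.mk' p.K (MulAut.conjNormal g a : p.P) = _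
    rw [MulAut.conjNormal_apply, map_mul, map_mul, map_inv]
    rfl
  act_bd := by
    intro a b
    exact Subtype.ext (MulAut.conjNormal_apply b.1 a)

/-! ### Permutation bimodules, tensor products and irreducible modules -/

section PermModule

variable (k : Type u) (X : Type v) [Field k]

/-- The free `k`-module `k[X]` on a set `X`. -/
def PermModule : Type (max u v) := X →₀ k

instance : AddCommGroup (PermModule k X) := inferInstanceAs (AddCommGroup (X →₀ k))

instance : Module k (PermModule k X) := inferInstanceAs (Module k (X →₀ k))

/-- The endomorphism of `k[X]` extending a map `X → X` linearly. -/
def PermModule.endo (f : X → X) : Module.End k (PermModule k X) := Finsupp.lmapDomain k k f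

variable {k X} in
/-- The multiple `d x` of a basis element of `k[X]`. -/
def PermModule.single (x : X) (d : k) : PermModule k X := Finsupp.single x d

variable {k X} in
theorem PermModule.endo_single (f : X → X) (c d : k) (x : X) :
    (c • PermModule.endo k X f) (PermModule.single x d) = PermModule.single (f x) (c * d) := by
  change c • (Finsupp.mapDomain f (Finsupp.single x d) : X →₀ k) = (Finsupp.single (f x) (c * d))
  rw [Finsupp.mapDomain_single, Finsupp.smul_single, smul_eq_mul]

variable {k X} in
theorem PermModule.induction {p : PermModule k X → Prop} (x : PermModule k X) (h0 : p 0)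
    (hadd : ∀ y z, p y → p z → p (y + z)) (hs : ∀ y d, p (PermModule.single y d)) : p x :=
  Finsupp.induction_linear (motive := p) x h0 hadd hs

variable {A B : Type w} [Monoid A] [Monoid B]

variable (A) in
/-- `k[A] → End_k(k[X])` for a left `A`-set `X`. -/
def PermModule.leftHom [MulAction A X] :
    MonoidAlgebra k A →ₐ[k] Module.End k (PermModule k X) :=
  MonoidAlgebra.lift k _ A
    { toFun := fun a => PermModule.endo k X (a • ·)
      map_one' := by
        have : ((1 : A) • · : X → X) = id := funext (one_smul A)
        rw [this]
        exact Finsupp.lmapDomain_id k k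
      map_mul' := fun a b => by
        have : ((a * b) • · : X → X) = (a • ·) ∘ (b • ·) := funext (mul_smul a b)
        rw [this]
        exact Finsupp.lmapDomain_comp k k _ _ }

variable (B) in
/-- `k[B] → End_k(k[X])^op` for a right `B`-set `X`. -/
def PermModule.rightHom [MulAction Bᵐᵒᵖ X] :
    MonoidAlgebra k B →ₐ[k] (Module.End k (PermModule k X))ᵐᵒᵖ :=
  MonoidAlgebra.lift k _ B
    { toFun := fun b => MulOpposite.op (PermModule.endo k X (MulOpposite.op b • ·))
      map_one' := by
        have : ((MulOpposite.op (1 : B)) • · : X → X) = id := funext (one_smul Bᵐᵒᵖ)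
        rw [this]
        exact congrArg MulOpposite.op (Finsupp.lmapDomain_id k k)
      map_mul' := fun a b => by
        have : (MulOpposite.op (a * b) • · : X → X) =
            (MulOpposite.op b • ·) ∘ (MulOpposite.op a • ·) :=
          funext (mul_smul (MulOpposite.op b) (MulOpposite.op a))
        rw [this]
        exact congrArg MulOpposite.op (Finsupp.lmapDomain_comp k k _ _) }

instance [MulAction A X] : Module (MonoidAlgebra k A) (PermModule k X) :=
  Module.compHom _ (PermModule.leftHom k X A).toRingHom

instance [MulAction Bᵐᵒᵖ X] : Module (MonoidAlgebra k B)ᵐᵒᵖ (PermModule k X) :=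
  Module.compHom _ ((RingEquiv.opOp _).symm.toRingHom.comp (PermModule.rightHom k X B).toRingHom.op)

theorem PermModule.smul_def [MulAction A X] (a : MonoidAlgebra k A) (x : PermModule k X) :
    a • x = PermModule.leftHom k X A a x := rfl

theorem PermModule.op_smul_def [MulAction Bᵐᵒᵖ X] (b : MonoidAlgebra k B) (x : PermModule k X) :
    MulOpposite.op b • x = (PermModule.rightHom k X B b).unop x := rfl

theorem PermModule.leftHom_single [MulAction A X] (a : A) (c d : k) (x : X) :
    PermModule.leftHom k X A (MonoidAlgebra.single a c) (PermModule.single x d) =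
      PermModule.single (a • x) (c * d) := by
  rw [PermModule.leftHom, MonoidAlgebra.lift_single]
  exact PermModule.endo_single _ c d x

theorem PermModule.rightHom_single [MulAction Bᵐᵒᵖ X] (b : B) (c d : k) (x : X) :
    (PermModule.rightHom k X B (MonoidAlgebra.single b c)).unop (PermModule.single x d) =
      PermModule.single (MulOpposite.op b • x) (c * d) := by
  rw [PermModule.rightHom, MonoidAlgebra.lift_single]
  exact PermModule.endo_single _ c d x

instance [MulAction A X] [MulAction Bᵐᵒᵖ X] [SMulCommClass A Bᵐᵒᵖ X] :
    SMulCommClass (MonoidAlgebra k A) (MonoidAlgebra k B)ᵐᵒᵖ (PermModule k X) where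
  smul_comm a b x := by
    obtain ⟨b, rfl⟩ := MulOpposite.op_surjective b
    rw [PermModule.op_smul_def, PermModule.op_smul_def, PermModule.smul_def, PermModule.smul_def]
    induction a using MonoidAlgebra.induction_linear with
    | zero => simp
    | add a a' h h' => simp only [map_add, LinearMap.add_apply, h, h']
    | single a c =>
      induction b using MonoidAlgebra.induction_linear with
      | zero => simp
      | add b b' h h' => simp only [map_add, MulOpposite.unop_add, LinearMap.add_apply, h, h']
      | single b d =>
        induction x using PermModule.induction with
        | h0 => simp only [map_zero]
        | hadd y z hy hz => simp only [map_add, hy, hz]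
        | hs y e =>
          rw [PermModule.rightHom_single, PermModule.leftHom_single, PermModule.leftHom_single,
            PermModule.rightHom_single, smul_comm a (MulOpposite.op b) y, mul_left_comm]

end PermModule

section BalancedTensor

variable (A : Type u) (B : Type v) [Ring A] [Ring B] (X : Type w) [AddCommGroup X] [Module A X]
  [Module Bᵐᵒᵖ X] [SMulCommClass A Bᵐᵒᵖ X]

/-- The relations `x b ⊗ m - x ⊗ b m`.  (They are permuted by the action of `A` on `X ⊗ M`, so their
`A`-span is the additive subgroup they generate.) -/
def balancedRel (M : Type*) [AddCommGroup M] [Module B M] : Submodule A (X ⊗[ℤ] M) :=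
  Submodule.span A {z | ∃ (x : X) (b : B) (m : M),
    z = (MulOpposite.op b • x) ⊗ₜ[ℤ] m - x ⊗ₜ[ℤ] (b • m)}

/-- The tensor product `X ⊗_B M` of an `(A, B)`-bimodule and a left `B`-module, an `A`-module. -/
abbrev BalancedTensor (M : Type*) [AddCommGroup M] [Module B M] : Type _ :=
  (X ⊗[ℤ] M) ⧸ balancedRel A B X M

/-- The `A`-linear map `x ⊗ m ↦ x ⊗ f m`. -/
def BalancedTensor.map {M N : Type*} [AddCommGroup M] [Module B M] [AddCommGroup N] [Module B N]
    (f : M →ₗ[B] N) : BalancedTensor A B X M →ₗ[A] BalancedTensor A B X N :=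
  Submodule.mapQ _ _ (TensorProduct.AlgebraTensorModule.lTensor A X f.toAddMonoidHom.toIntLinearMap)
    (by
      rw [balancedRel, Submodule.span_le]
      rintro _ ⟨x, b, m, rfl⟩
      exact Submodule.subset_span ⟨x, b, f m, by simp⟩)

open CategoryTheory in
/-- The functor `X ⊗_B -` from left `B`-modules to left `A`-modules. -/
def tensorFunctor : ModuleCat.{max v w} B ⥤ ModuleCat.{max v w} A where
  obj M := ModuleCat.of A (BalancedTensor A B X M)
  map f := ModuleCat.ofHom (BalancedTensor.map A B X f.hom)
  map_id M := by
    refine ModuleCat.hom_ext (LinearMap.ext fun z => ?_)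
    obtain ⟨z, rfl⟩ := Submodule.Quotient.mk_surjective _ z
    induction z using TensorProduct.induction_on with
    | zero => rfl
    | tmul x m => rfl
    | add y z hy hz => rw [Submodule.Quotient.mk_add, map_add, map_add, hy, hz]
  map_comp f g := by
    refine ModuleCat.hom_ext (LinearMap.ext fun z => ?_)
    obtain ⟨z, rfl⟩ := Submodule.Quotient.mk_surjective _ z
    induction z using TensorProduct.induction_on with
    | zero => rfl
    | tmul x m => rfl
    | add y z hy hz => rw [Submodule.Quotient.mk_add, map_add, map_add, hy, hz]

end BalancedTensor

open CategoryTheory in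
/-- The functor `k[X] ⊗_{kB} -` from `kB`-modules to `kA`-modules given by an `(A, B)`-biset `X`. -/
def bisetFunctor (k : Type u) [Field k] (A B X : Type v) [Monoid A] [Monoid B] [MulAction A X]
    [MulAction Bᵐᵒᵖ X] [SMulCommClass A Bᵐᵒᵖ X] :
    ModuleCat.{max u v} (MonoidAlgebra k B) ⥤ ModuleCat.{max u v} (MonoidAlgebra k A) :=
  tensorFunctor (MonoidAlgebra k A) (MonoidAlgebra k B) (PermModule k X)

open CategoryTheory in
/-- Isomorphism of simple `R`-modules. -/
instance irrSetoid (R : Type u) [Ring R] :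
    Setoid {M : ModuleCat.{v} R // IsSimpleModule R M} where
  r M N := Nonempty (M.1 ≅ N.1)
  iseqv :=
    { refl := fun _ => ⟨Iso.refl _⟩
      symm := fun ⟨e⟩ => ⟨e.symm⟩
      trans := fun ⟨e⟩ ⟨e'⟩ => ⟨e.trans e'⟩ }

/-- `Irr(R)`: isomorphism classes of simple `R`-modules. -/
def Irr (R : Type u) [Ring R] : Type (max u (v + 1)) := Quotient (irrSetoid.{u, v} R)

/-- The isomorphism class of a simple `R`-module. -/
def Irr.mk {R : Type u} [Ring R] (M : ModuleCat.{v} R) (h : IsSimpleModule R M) : Irr.{u, v} R :=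
  Quotient.mk _ ⟨M, h⟩

end SectionBiset

end

open SectionBiset

/-!
For commuting normal pairs `p = (K, P)` of `G` and `q = (L, Q)` of `H`, the sections `(T, S)` of
`G × H` with invariants `p` and `q` are relations that are total on both sides: `T` is the graph of
an isomorphism `H/L ≃ G/K` and `S` the graph of an isomorphism `Q ≃ P`.  Such sections compose as
relations, and with the diagonal sections as identities and the swapped sections as inverses they
form a groupoid, whose laws are equalities of subgroups (`GroupSection.comp_assoc`,
`HasInvariants.diagSection_comp`, `HasInvariants.comp_swap`).

The product of two classes is `[T, S] [T', S'] = |H : Q| [T T', S S']` (`sliceClass_comp_proj`): the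
set `(G × H)/T ×_H (H × J)/T'` is transitive because `T` projects onto `H`, and all points of
`(G × H)/S ×_H (H × J)/S'` over its base point have the same stabilizer, since `T` normalizes `S`
and `T'` normalizes `S'`; the number of orbits is found by counting points, `H` acting freely on
`(G × H)/S`.  The normalizing factor `1/|G : P|` absorbs the multiplicity, so the groupoid laws
descend to `Γ_{(G,K,P)}` and to the biset, which is a bitorsor (`isBitorsor_gamBi`).

A point `x₀` of an `(A, B)`-bitorsor identifies `B` with `A` through `φ(b) x₀ = x₀ b`, and
`m ↦ x₀ ⊗ m` identifies `M` with `k[X] ⊗_{kB} M`, the group algebra `kA` acting on `M` through `φ⁻¹`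
(`bisetFunctorIso`).  Hence the functor is restriction along a ring isomorphism, up to isomorphism.

Finally, an automorphism of the crossed module `(P, G/K, i_P)` is the same as a section with
invariants `p` on both sides (`CommPair.exists_autSection_eq`).  Marks, which count the points of
`X` fixed by `S` that lie over points fixed by `T`, show that two sections have the same class only
if they are conjugate, and the sections conjugate to the diagonal one come from the inner
automorphisms (`CommPair.ker_autHom`).
-/

noncomputable section

namespace SectionBiset

/-! ### The groupoid of sections with prescribed invariants -/

section Sections

variable {G H J : Type u} [Group G] [Group H] [Group J]

@[ext]
theorem GroupSection.ext {s s' : GroupSection G} (hT : ∀ x, x ∈ s.T ↔ x ∈ s'.T)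
    (hS : ∀ x, x ∈ s.S ↔ x ∈ s'.S) : s = s' := by
  obtain ⟨T, S, _, _⟩ := s
  obtain ⟨T', S', _, _⟩ := s'
  obtain rfl : T = T' := Subgroup.ext hT
  obtain rfl : S = S' := Subgroup.ext hS
  rfl

/-- The composite of two subgroups of direct products, viewed as relations. -/
def relComp (U : Subgroup (G × H)) (V : Subgroup (H × J)) : Subgroup (G × J) where
  carrier := {x | ∃ h, (x.1, h) ∈ U ∧ (h, x.2) ∈ V}
  one_mem' := ⟨1, U.one_mem, V.one_mem⟩
  mul_mem' := by
    rintro a b ⟨h, h1, h2⟩ ⟨h', h1', h2'⟩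
    exact ⟨h * h', U.mul_mem h1 h1', V.mul_mem h2 h2'⟩
  inv_mem' := by
    rintro a ⟨h, h1, h2⟩
    exact ⟨h⁻¹, U.inv_mem h1, V.inv_mem h2⟩

namespace GroupSection

theorem conj_mem_iff (s : GroupSection G) {t x : G} (ht : t ∈ s.T) :
    t * x * t⁻¹ ∈ s.S ↔ x ∈ s.S := by
  refine ⟨fun h => ?_, s.conj_mem ht⟩
  simpa [mul_assoc] using s.conj_mem (s.T.inv_mem ht) h

/-- Build a section from subgroups `S ≤ T` such that `T` normalizes `S`. -/
def ofConj (T S : Subgroup G) (le : S ≤ T) (h : ∀ t ∈ T, ∀ x ∈ S, t * x * t⁻¹ ∈ S) :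
    GroupSection G where
  T := T
  S := S
  le := le
  normal := ⟨fun x hx t => Subgroup.mem_subgroupOf.2
    (h t.1 t.2 x.1 (Subgroup.mem_subgroupOf.1 hx))⟩

/-- The composite of sections of `G × H` and `H × J`, as relations. -/
def comp (s : GroupSection (G × H)) (s' : GroupSection (H × J)) : GroupSection (G × J) :=
  ofConj (relComp s.T s'.T) (relComp s.S s'.S)
    (fun _ ⟨h, h1, h2⟩ => ⟨h, s.le h1, s'.le h2⟩)
    (by
      rintro t ⟨h, h1, h2⟩ x ⟨h', h1', h2'⟩
      exact ⟨h * h' * h⁻¹, s.conj_mem h1 h1', s'.conj_mem h2 h2'⟩)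

theorem mem_comp_T {s : GroupSection (G × H)} {s' : GroupSection (H × J)} {x : G × J} :
    x ∈ (s.comp s').T ↔ ∃ h, (x.1, h) ∈ s.T ∧ (h, x.2) ∈ s'.T := Iff.rfl

theorem mem_comp_S {s : GroupSection (G × H)} {s' : GroupSection (H × J)} {x : G × J} :
    x ∈ (s.comp s').S ↔ ∃ h, (x.1, h) ∈ s.S ∧ (h, x.2) ∈ s'.S := Iff.rfl

/-- The section of `H × G` obtained from a section of `G × H` by swapping the factors. -/
def swap (s : GroupSection (G × H)) : GroupSection (H × G) :=
  ofConj (s.T.comap (MulEquiv.prodComm : H × G ≃* G × H).toMonoidHom)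
    (s.S.comap (MulEquiv.prodComm : H × G ≃* G × H).toMonoidHom)
    (fun _ h => s.le h) (fun _ ht _ hx => s.conj_mem (t := Prod.swap _) ht hx)

theorem mem_swap_T {s : GroupSection (G × H)} {x : H × G} :
    x ∈ s.swap.T ↔ (x.2, x.1) ∈ s.T := Iff.rfl

theorem mem_swap_S {s : GroupSection (G × H)} {x : H × G} :
    x ∈ s.swap.S ↔ (x.2, x.1) ∈ s.S := Iff.rfl

theorem comp_assoc {M : Type u} [Group M] (s : GroupSection (G × H)) (s' : GroupSection (H × J))
    (s'' : GroupSection (J × M)) : (s.comp s').comp s'' = s.comp (s'.comp s'') := by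
  ext x
  · simp only [mem_comp_T]
    exact ⟨fun ⟨j, ⟨h, h1, h2⟩, h3⟩ => ⟨h, h1, j, h2, h3⟩,
      fun ⟨h, h1, j, h2, h3⟩ => ⟨j, ⟨h, h1, h2⟩, h3⟩⟩
  · simp only [mem_comp_S]
    exact ⟨fun ⟨j, ⟨h, h1, h2⟩, h3⟩ => ⟨h, h1, j, h2, h3⟩,
      fun ⟨h, h1, j, h2, h3⟩ => ⟨j, ⟨h, h1, h2⟩, h3⟩⟩

end GroupSection

/-- Elementwise form of the conditions on the left invariants of a section. -/
structure LeftInvariants (p : CommPair G) (s : GroupSection (G × H)) : Prop where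
  exists_T : ∀ g, ∃ h, (g, h) ∈ s.T
  mem_T_one : ∀ g, (g, 1) ∈ s.T ↔ g ∈ p.K
  exists_S : ∀ g, (∃ h, (g, h) ∈ s.S) ↔ g ∈ p.P
  eq_one : ∀ g, (g, 1) ∈ s.S → g = 1

theorem leftInvariants_iff {p : CommPair G} {s : GroupSection (G × H)} :
    LeftInvariants p s ↔ s.left = (⊤, p.K, p.P, ⊥) := by
  simp only [GroupSection.left, Prod.mk.injEq, Subgroup.ext_iff, Subgroup.mem_map,
    Subgroup.mem_comap, MonoidHom.inl_apply, MonoidHom.coe_fst, Prod.exists, Subgroup.mem_top,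
    Subgroup.mem_bot, iff_true]
  constructor
  · rintro ⟨h1, h2, h3, h4⟩
    refine ⟨fun g => ?_, h2, fun g => ?_, fun g => ⟨h4 g, ?_⟩⟩
    · obtain ⟨h, hh⟩ := h1 g
      exact ⟨g, h, hh, rfl⟩
    · rw [← h3]
      exact ⟨fun ⟨a, b, hab, e⟩ => ⟨b, e ▸ hab⟩, fun ⟨h, hh⟩ => ⟨g, h, hh, rfl⟩⟩
    · rintro rfl
      exact s.S.one_mem
  · rintro ⟨h1, h2, h3, h4⟩
    refine ⟨fun g => ?_, h2, fun g => ?_, fun g => (h4 g).1⟩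
    · obtain ⟨a, b, hab, e⟩ := h1 g
      exact ⟨b, e ▸ hab⟩
    · rw [← h3]
      exact ⟨fun ⟨h, hh⟩ => ⟨g, h, hh, rfl⟩, fun ⟨a, b, hab, e⟩ => ⟨b, e ▸ hab⟩⟩

theorem leftInvariants_swap_iff {q : CommPair H} {s : GroupSection (G × H)} :
    LeftInvariants q s.swap ↔ s.right = (⊤, q.K, q.P, ⊥) := by
  rw [leftInvariants_iff]
  have e : s.swap.left = s.right := by
    simp only [GroupSection.left, GroupSection.right, Prod.mk.injEq]
    refine ⟨?_, rfl, ?_, rfl⟩ <;>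
    · ext h
      simp only [Subgroup.mem_map, Prod.exists]
      exact ⟨fun ⟨a, b, hab, e⟩ => ⟨b, a, hab, e⟩, fun ⟨a, b, hab, e⟩ => ⟨b, a, hab, e⟩⟩
  rw [e]

theorem hasInvariants_iff {p : CommPair G} {q : CommPair H} {s : GroupSection (G × H)} :
    HasInvariants p q s ↔ LeftInvariants p s ∧ LeftInvariants q s.swap := by
  rw [leftInvariants_iff, leftInvariants_swap_iff, HasInvariants]

variable {p : CommPair G} {q : CommPair H} {r : CommPair J}

theorem HasInvariants.swap {s : GroupSection (G × H)} (h : HasInvariants p q s) :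
    HasInvariants q p s.swap :=
  hasInvariants_iff.2 (hasInvariants_iff.1 h).symm

theorem LeftInvariants.comp {s : GroupSection (G × H)} {s' : GroupSection (H × J)}
    (hp : LeftInvariants p s) (hq : LeftInvariants q s.swap) (hq' : LeftInvariants q s') :
    LeftInvariants p (s.comp s') := by
  refine ⟨fun g => ?_, fun g => ?_, fun g => ?_, ?_⟩
  · obtain ⟨h, hh⟩ := hp.exists_T g
    obtain ⟨j, hj⟩ := hq'.exists_T h
    exact ⟨j, h, hh, hj⟩
  · rw [← hp.mem_T_one]
    constructor
    · rintro ⟨h, h1, h2⟩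
      have h3 : (1, h) ∈ s.T := (hq.mem_T_one h).2 ((hq'.mem_T_one h).1 h2)
      simpa using s.T.mul_mem h1 (s.T.inv_mem h3)
    · intro h
      exact ⟨1, h, s'.T.one_mem⟩
  · rw [← hp.exists_S]
    constructor
    · rintro ⟨j, h, h1, h2⟩
      exact ⟨h, h1⟩
    · rintro ⟨h, h1⟩
      obtain ⟨j, hj⟩ := (hq'.exists_S h).2 ((hq.exists_S h).1 ⟨g, h1⟩)
      exact ⟨j, h, h1, hj⟩
  · rintro g ⟨h, h1, h2⟩
    obtain rfl := hq'.eq_one h h2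
    exact hp.eq_one g h1

theorem HasInvariants.comp {s : GroupSection (G × H)} {s' : GroupSection (H × J)}
    (h : HasInvariants p q s) (h' : HasInvariants q r s') : HasInvariants p r (s.comp s') := by
  rw [hasInvariants_iff] at *
  refine ⟨h.1.comp h.2 h'.1, ?_⟩
  have e : (s.comp s').swap = s'.swap.comp s.swap := by
    ext x
    · simp only [GroupSection.mem_comp_T, GroupSection.mem_swap_T, and_comm]
    · simp only [GroupSection.mem_comp_S, GroupSection.mem_swap_S, and_comm]
  rw [e]
  exact h'.2.comp (s' := s.swap) h'.1 h.2

theorem CommPair.mem_diagSection_T {x : G × G} : x ∈ p.diagSection.T ↔ x.2⁻¹ * x.1 ∈ p.K := Iff.rfl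

theorem CommPair.mem_diagSection_S {x : G × G} :
    x ∈ p.diagSection.S ↔ x.1 = x.2 ∧ x.1 ∈ p.P := by
  constructor
  · rintro ⟨y, hy, rfl⟩
    exact ⟨rfl, hy⟩
  · rintro ⟨e, h⟩
    exact ⟨x.1, h, Prod.ext rfl e⟩

theorem CommPair.diagSection_swap : p.diagSection.swap = p.diagSection := by
  ext x
  · rw [GroupSection.mem_swap_T, CommPair.mem_diagSection_T, CommPair.mem_diagSection_T,
      ← inv_mem_iff]
    simp
  · rw [GroupSection.mem_swap_S, CommPair.mem_diagSection_S, CommPair.mem_diagSection_S]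
    obtain ⟨x, y⟩ := x
    constructor
    · rintro ⟨h, h'⟩
      dsimp only at *
      exact ⟨h.symm, h ▸ h'⟩
    · rintro ⟨h, h'⟩
      dsimp only at *
      exact ⟨h.symm, h ▸ h'⟩

theorem CommPair.diagSection_hasInvariants : HasInvariants p p p.diagSection := by
  rw [hasInvariants_iff, CommPair.diagSection_swap, and_self]
  refine ⟨fun g => ⟨g, by simp [mem_diagSection_T]⟩, fun g => by simp [mem_diagSection_T],
    fun g => ?_, fun g h => (mem_diagSection_S.1 h).1⟩
  simp only [mem_diagSection_S]
  exact ⟨fun ⟨_, h⟩ => h.2, fun h => ⟨g, rfl, h⟩⟩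

theorem HasInvariants.diagSection_comp {s : GroupSection (G × H)} (h : HasInvariants p q s) :
    p.diagSection.comp s = s := by
  have hp := (hasInvariants_iff.1 h).1
  ext ⟨g, h⟩
  · simp only [GroupSection.mem_comp_T, CommPair.mem_diagSection_T]
    constructor
    · rintro ⟨a, h1, h2⟩
      have := s.T.mul_mem h2 ((hp.mem_T_one _).2 h1)
      simpa using this
    · exact fun h1 => ⟨g, by simp, h1⟩
  · simp only [GroupSection.mem_comp_S, CommPair.mem_diagSection_S]
    constructor
    · rintro ⟨a, ⟨rfl, h1⟩, h2⟩
      exact h2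
    · exact fun h1 => ⟨g, ⟨rfl, (hp.exists_S g).1 ⟨h, h1⟩⟩, h1⟩

theorem HasInvariants.comp_diagSection {s : GroupSection (G × H)} (h : HasInvariants p q s) :
    s.comp q.diagSection = s := by
  have hq := (hasInvariants_iff.1 h).2
  ext ⟨g, h⟩
  · simp only [GroupSection.mem_comp_T, CommPair.mem_diagSection_T]
    constructor
    · rintro ⟨a, h1, h2⟩
      have h3 : (1, h⁻¹ * a) ∈ s.T := (hq.mem_T_one _).2 h2
      simpa using s.T.mul_mem h1 (s.T.inv_mem h3)
    · exact fun h1 => ⟨h, h1, by simp⟩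
  · simp only [GroupSection.mem_comp_S, CommPair.mem_diagSection_S]
    constructor
    · rintro ⟨a, h1, rfl, h2⟩
      exact h1
    · exact fun h1 => ⟨h, h1, rfl, (hq.exists_S h).1 ⟨g, h1⟩⟩

theorem HasInvariants.comp_swap {s : GroupSection (G × H)} (h : HasInvariants p q s) :
    s.comp s.swap = p.diagSection := by
  obtain ⟨hp, hq⟩ := hasInvariants_iff.1 h
  ext ⟨g, g'⟩
  · simp only [GroupSection.mem_comp_T, CommPair.mem_diagSection_T, GroupSection.mem_swap_T]
    rw [← hp.mem_T_one]
    constructor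
    · rintro ⟨a, h1, h2⟩
      simpa using s.T.mul_mem (s.T.inv_mem h2) h1
    · intro h
      obtain ⟨a, ha⟩ := hp.exists_T g'
      exact ⟨a, by simpa using s.T.mul_mem ha h, ha⟩
  · simp only [GroupSection.mem_comp_S, CommPair.mem_diagSection_S, GroupSection.mem_swap_S]
    constructor
    · rintro ⟨a, h1, h2⟩
      have h3 := s.S.mul_mem h1 (s.S.inv_mem h2)
      simp only [Prod.inv_mk, Prod.mk_mul_mk, mul_inv_cancel] at h3
      exact ⟨mul_inv_eq_one.1 (hp.eq_one _ h3), (hp.exists_S g).1 ⟨a, h1⟩⟩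
    · rintro ⟨rfl, h⟩
      obtain ⟨a, ha⟩ := (hp.exists_S g).2 h
      exact ⟨a, ha, ha⟩

theorem HasInvariants.swap_comp {s : GroupSection (G × H)} (h : HasInvariants p q s) :
    s.swap.comp s = q.diagSection := h.swap.comp_swap

theorem HasInvariants.card_S {s : GroupSection (G × H)} (h : HasInvariants p q s) :
    Nat.card s.S = Nat.card q.P := by
  obtain ⟨hp, hq⟩ := hasInvariants_iff.1 h
  refine Nat.card_congr (Equiv.ofBijective (fun x => ⟨x.1.2, (hq.exists_S _).1 ⟨x.1.1, x.2⟩⟩)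
    ⟨?_, ?_⟩)
  · rintro ⟨⟨g, h⟩, h1⟩ ⟨⟨g', h'⟩, h1'⟩ e
    obtain rfl : h = h' := congrArg Subtype.val e
    have h3 := s.S.mul_mem h1 (s.S.inv_mem h1')
    simp only [Prod.inv_mk, Prod.mk_mul_mk, mul_inv_cancel] at h3
    obtain rfl := mul_inv_eq_one.1 (hp.eq_one _ h3)
    rfl
  · rintro ⟨h, hh⟩
    obtain ⟨g, hg⟩ := (hq.exists_S h).2 hh
    exact ⟨⟨(g, h), hg⟩, rfl⟩

end Sections

/-! ### Classes of morphisms over a transitive set -/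

section Uniform

variable {G : Type u} [Group G]

/-- The restriction of a morphism to a sub-`G`-set of its source. -/
def FinMor.restrict (f : FinMor G) (A : SubMulAction G f.X) : FinMor G where
  X := A
  Y := f.Y
  map := { toFun := fun x => f.map x.1, map_smul' := fun g x => map_smul f.map g x.1 }

theorem sliceClass_restrict_add_compl (f : FinMor G) (A B : SubMulAction G f.X)
    (h : ∀ x, x ∈ B ↔ x ∉ A) :
    sliceClass f = sliceClass (f.restrict A) + sliceClass (f.restrict B) := by
  refine sliceClass_add (F := f) (F₁ := f.restrict A) (F₂ := f.restrict B)
    (fun x : A => x.1) (fun x : B => x.1) id id (fun _ _ => rfl) (fun _ _ => rfl)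
    (fun _ _ => rfl) (fun _ _ => rfl) Function.injective_id Function.injective_id
    (fun _ => rfl) (fun _ => rfl) ⟨?_, ?_⟩
  · rintro (⟨x, hx⟩ | ⟨x, hx⟩) (⟨y, hy⟩ | ⟨y, hy⟩) e <;> obtain rfl : x = y := e
    · rfl
    · exact ((h x).1 hy hx).elim
    · exact ((h x).1 hx hy).elim
    · rfl
  · intro x
    by_cases hx : x ∈ A
    · exact ⟨Sum.inl ⟨x, hx⟩, rfl⟩
    · exact ⟨Sum.inr ⟨x, (h x).2 hx⟩, rfl⟩

theorem sliceClass_of_isEmpty_source (f : FinMor G) (h : IsEmpty f.X) : sliceClass f = 0 := by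
  rw [← sliceClass_ontoImage]
  refine sliceClass_of_isEmpty _ ⟨?_⟩
  rintro ⟨_, x, _⟩
  exact h.elim x

/-- The bijection `G/U ≃ X` onto a transitive `G`-set with point stabilizer `U`. -/
def quotientEquivOfTransitive {X : Type u} [MulAction G X] (U : Subgroup G) (x : X)
    (hU : ∀ g : G, g • x = x ↔ g ∈ U) (ht : ∀ y, ∃ g : G, g • x = y) : G ⧸ U ≃ X :=
  Equiv.ofBijective (Quotient.lift (fun g : G => g • x) (by
      intro a b hab
      have hab : a⁻¹ * b ∈ U := QuotientGroup.leftRel_apply.1 hab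
      rw [← hU, mul_smul, inv_smul_eq_iff] at hab
      exact hab.symm))
    ⟨by
      rintro ⟨a⟩ ⟨b⟩ hab
      refine QuotientGroup.eq.2 ((hU _).1 ?_)
      rw [mul_smul, inv_smul_eq_iff]
      exact Eq.symm hab, by
      intro y
      obtain ⟨g, hg⟩ := ht y
      exact ⟨QuotientGroup.mk g, hg⟩⟩

theorem proj_iso [Finite G] (s : GroupSection G) (f : FinMor G) (x : f.X)
    (hx : ∀ g : G, g • x = x ↔ g ∈ s.S) (hy : ∀ g : G, g • f.map x = f.map x ↔ g ∈ s.T)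
    (htx : ∀ y, ∃ g : G, g • x = y) (hty : ∀ y, ∃ g : G, g • f.map x = y) : s.proj.Iso f := by
  refine ⟨quotientEquivOfTransitive s.S x hx htx, quotientEquivOfTransitive s.T _ hy hty,
    ?_, ?_, ?_⟩
  · rintro g ⟨a⟩
    exact mul_smul g a x
  · rintro g ⟨a⟩
    exact mul_smul g a (f.map x)
  · rintro ⟨a⟩
    exact map_smul f.map a x

/-- If `Y` is transitive with point stabilizer `T` and all points of the fibre over the base point
have stabilizer `S`, then `X → Y` is a sum of copies of `G/S → G/T`, one for each orbit of `X`. -/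
theorem sliceClass_eq_nsmul [Finite G] (s : GroupSection G) (n : ℕ) (f : FinMor G) (y : f.Y)
    (hty : ∀ z, ∃ g : G, g • y = z) (hy : ∀ g : G, g • y = y ↔ g ∈ s.T)
    (hx : ∀ x, f.map x = y → ∀ g : G, g • x = x ↔ g ∈ s.S)
    (hcard : Nat.card f.X = n * s.S.index) : sliceClass f = n • sliceClass s.proj := by
  induction n generalizing f with
  | zero =>
    rw [zero_mul, Finite.card_eq_zero_iff] at hcard
    rw [zero_smul, sliceClass_of_isEmpty_source f hcard]
  | succ n ih =>
    have hne : Nonempty f.X := by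
      rw [← Finite.card_pos_iff, hcard]
      exact Nat.mul_pos n.succ_pos (Nat.pos_of_ne_zero s.S.index_ne_zero_of_finite)
    -- Split off the orbit of a point over `y`; the rest satisfies the same hypotheses.
    obtain ⟨x, rfl⟩ : ∃ x, f.map x = y := by
      obtain ⟨x⟩ := hne
      obtain ⟨g, hg⟩ := hty (f.map x)
      exact ⟨g⁻¹ • x, by rw [map_smul, ← hg, inv_smul_smul]⟩
    let A : SubMulAction G f.X :=
      { carrier := MulAction.orbit G x
        smul_mem' := by
          rintro g _ ⟨h, rfl⟩
          exact ⟨g * h, mul_smul g h x⟩ }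
    let B : SubMulAction G f.X :=
      { carrier := {z | z ∉ A}
        smul_mem' := by
          intro g z hz hz'
          exact hz (by simpa using A.smul_mem g⁻¹ hz') }
    have isoA : s.proj.Iso (f.restrict A) := by
      refine proj_iso s (f.restrict A) ⟨x, 1, one_smul G x⟩ (fun g => ?_) hy ?_ hty
      · rw [← hx x rfl]
        exact Subtype.ext_iff
      · rintro ⟨_, g, rfl⟩
        exact ⟨g, Subtype.ext rfl⟩
    have hA : Nat.card A = s.S.index := Nat.card_congr isoA.choose.symm
    have hcB : Nat.card f.X = Nat.card A + Nat.card B := by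
      classical
      rw [← Nat.card_sum]
      exact Nat.card_congr (Equiv.sumCompl (fun z => z ∈ A)).symm
    rw [sliceClass_restrict_add_compl f A B (fun _ => Iff.rfl), ← sliceClass_eq_of_iso isoA,
      succ_nsmul']
    congr 1
    refine ih (f.restrict B) (f.map x) hty hy (fun z hz g => ?_) ?_
    · rw [← hx z.1 hz]
      exact Subtype.ext_iff
    · have h1 : Nat.card (f.restrict B).X = Nat.card B := rfl
      rw [hcard, hA, add_mul, one_mul, add_comm] at hcB
      rw [h1]
      exact (Nat.add_left_cancel hcB).symm

end Uniform

/-! ### The composition product on classes of sections -/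

section Product

variable {G H J : Type u} [Group G] [Group H] [Group J]

/-- The class of a pair in the amalgamated product. -/
abbrev Amalg.mk {X X' : Type u} [MulAction (G × H) X] [MulAction (H × J) X'] (x : X) (x' : X') :
    Amalg G H J X X' := Quotient.mk _ (x, x')

theorem Amalg.mk_eq_mk_iff {X X' : Type u} [MulAction (G × H) X] [MulAction (H × J) X'] {x y : X}
    {x' y' : X'} : (Amalg.mk x x' : Amalg G H J X X') = Amalg.mk y y' ↔
      ∃ h : H, ((1, h) : G × H) • y = x ∧ ((h, 1) : H × J) • y' = x' := by
  rw [eq_comm]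
  refine Quotient.eq.trans ?_
  exact exists_congr fun h => and_congr eq_comm eq_comm

/-- `H` acts freely on `X × X'` as soon as it acts freely on `X`, so each class of the amalgamated
product has `|H|` elements. -/
theorem card_amalg {X X' : Type u} [MulAction (G × H) X] [MulAction (H × J) X']
    (hf : ∀ (h : H) (x : X), ((1, h) : G × H) • x = x → h = 1) :
    Nat.card X * Nat.card X' = Nat.card (Amalg G H J X X') * Nat.card H := by
  rw [← Nat.card_prod, ← Nat.card_prod]
  refine (Nat.card_congr (Equiv.ofBijective (fun z : Amalg G H J X X' × H =>
    ((((1, z.2) : G × H) • z.1.out.1, ((z.2, 1) : H × J) • z.1.out.2) : X × X'))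
    ⟨?_, ?_⟩)).symm
  · rintro ⟨z, h⟩ ⟨z', h'⟩ e
    simp only [Prod.mk.injEq] at e
    obtain rfl : z = z' := by
      rw [← Quotient.out_eq z, ← Quotient.out_eq z']
      refine Quotient.sound ⟨h'⁻¹ * h, ?_, ?_⟩
      · have := congrArg (fun y => ((1, h'⁻¹) : G × H) • y) e.1
        simpa [smul_smul, ← Prod.one_eq_mk] using this.symm
      · have := congrArg (fun y => ((h'⁻¹, 1) : H × J) • y) e.2
        simpa [smul_smul, ← Prod.one_eq_mk] using this.symm
    have h1 : h'⁻¹ * h = 1 := by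
      refine hf _ z.out.1 ?_
      have := congrArg (fun y => ((1, h'⁻¹) : G × H) • y) e.1
      simpa [smul_smul, ← Prod.one_eq_mk] using this
    rw [inv_mul_eq_one] at h1
    rw [h1]
  · rintro ⟨x, x'⟩
    obtain ⟨h, h1, h2⟩ := Quotient.exact (Quotient.out_eq
      (Quotient.mk (amalgSetoid G H J X X') (x, x')))
    exact ⟨(Quotient.mk _ (x, x'), h), Prod.ext h1.symm h2.symm⟩

theorem smul_mk_eq_mk_iff {U : Subgroup G} {g a b : G} :
    g • (QuotientGroup.mk a : G ⧸ U) = QuotientGroup.mk b ↔ b⁻¹ * (g * a) ∈ U := by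
  rw [MulAction.Quotient.smul_mk, smul_eq_mul, eq_comm, QuotientGroup.eq]

variable [Finite G] [Finite H] [Finite J]

/-- The multiplicity `|H : Q|` is the number of orbits of `(G × H)/S ×_H (H × J)/S'`. -/
theorem sliceClass_comp_proj {p : CommPair G} {q : CommPair H} {r : CommPair J}
    {s : GroupSection (G × H)} {s' : GroupSection (H × J)}
    (hs : HasInvariants p q s) (hs' : HasInvariants q r s') :
    sliceClass (s.proj.comp s'.proj) = q.P.index • sliceClass (s.comp s').proj := by
  obtain ⟨hp, hq⟩ := hasInvariants_iff.1 hs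
  obtain ⟨hq', -⟩ := hasInvariants_iff.1 hs'
  have mk_eq : ∀ (a b : G × H) (a' b' : H × J),
      (Amalg.mk (QuotientGroup.mk a) (QuotientGroup.mk a') :
        Amalg G H J ((G × H) ⧸ s.T) ((H × J) ⧸ s'.T)) =
          Amalg.mk (QuotientGroup.mk b) (QuotientGroup.mk b') ↔
        ∃ h : H, b⁻¹ * ((1, h) * a) ∈ s.T ∧ b'⁻¹ * ((h, 1) * a') ∈ s'.T := by
    intro a b a' b'
    rw [eq_comm, Amalg.mk_eq_mk_iff]
    simp only [smul_mk_eq_mk_iff]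
  refine sliceClass_eq_nsmul (s.comp s') _ (s.proj.comp s'.proj)
    (Amalg.mk (QuotientGroup.mk 1) (QuotientGroup.mk 1)) ?_ ?_ ?_ ?_
  · rintro ⟨⟨g, h⟩, ⟨h', j⟩⟩
    obtain ⟨g', hg'⟩ := hq.exists_T (h'⁻¹ * h)
    have hg' : (g', h'⁻¹ * h) ∈ s.T := hg'
    refine ⟨(g * g'⁻¹, j), ?_⟩
    refine (mk_eq ((g * g'⁻¹, 1) * 1) (g, h) ((1, j) * 1) (h', j)).2 ⟨h', ?_, ?_⟩
    · simpa using s.T.inv_mem hg'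
    · simp [← Prod.one_eq_mk, s'.T.one_mem]
  · rintro ⟨g, j⟩
    refine (mk_eq ((g, 1) * 1) 1 ((1, j) * 1) 1).trans ?_
    simp [GroupSection.mem_comp_T]
  -- A point over the base point has a representative `(aS, a'S')` with `a ∈ T` and `a' ∈ T'`; its
  -- stabilizer is then computed from `a S a⁻¹ = S` and `a' S' a'⁻¹ = S'`.
  · have key : ∀ (a : G × H) (a' : H × J), a ∈ s.T → a' ∈ s'.T → ∀ g : G × J,
        g • (Amalg.mk (QuotientGroup.mk a) (QuotientGroup.mk a') :
          Amalg G H J ((G × H) ⧸ s.S) ((H × J) ⧸ s'.S)) =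
          Amalg.mk (QuotientGroup.mk a) (QuotientGroup.mk a') ↔ g ∈ (s.comp s').S := by
      rintro a a' ha ha' ⟨g, j⟩
      change Amalg.mk (G := G) (H := H) (J := J)
        (((g, 1) : G × H) • (QuotientGroup.mk a : (G × H) ⧸ s.S))
        (((1, j) : H × J) • (QuotientGroup.mk a' : (H × J) ⧸ s'.S)) = Amalg.mk _ _ ↔ _
      rw [eq_comm, Amalg.mk_eq_mk_iff]
      refine exists_congr fun h => ?_
      rw [smul_smul, smul_smul, smul_mk_eq_mk_iff, smul_mk_eq_mk_iff, ← s.conj_mem_iff ha,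
        ← s'.conj_mem_iff ha']
      simp [mul_assoc]
    rintro ⟨⟨a⟩, ⟨a'⟩⟩ hx
    obtain ⟨h, h1, h2⟩ := (mk_eq a 1 a' 1).1 hx
    have h0 :
        (Amalg.mk (QuotientGroup.mk a) (QuotientGroup.mk a') :
          Amalg G H J ((G × H) ⧸ s.S) ((H × J) ⧸ s'.S)) =
          Amalg.mk (QuotientGroup.mk ((1, h) * a)) (QuotientGroup.mk ((h, 1) * a')) := by
      exact (Amalg.mk_eq_mk_iff.2 ⟨h, rfl, rfl⟩).symm
    intro g
    have h3 := key _ _ (by simpa using h1) (by simpa using h2) g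
    rw [← h0] at h3
    exact h3
  · have hfree : ∀ (h : H) (x : (G × H) ⧸ s.S), ((1, h) : G × H) • x = x → h = 1 := by
      rintro h ⟨a⟩ ha
      have h1 := smul_mk_eq_mk_iff.1 ha
      obtain ⟨a1, a2⟩ := a
      have h2 : (1, a2⁻¹ * (h * a2)) ∈ s.S := by simpa using h1
      have h3 := hq.eq_one _ h2
      rw [inv_mul_eq_one, eq_comm, mul_eq_right] at h3
      exact h3
    have hc := card_amalg (J := J) (X' := (H × J) ⧸ s'.S) hfree
    change s.S.index * s'.S.index = Nat.card (s.proj.comp s'.proj).X * Nat.card H at hc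
    have h1 := s.S.card_mul_index
    have h2 := s'.S.card_mul_index
    have h3 := (s.comp s').S.card_mul_index
    have h4 := q.P.card_mul_index
    have h5 : Nat.card s.S = Nat.card q.P := hs.card_S
    have h6 : Nat.card s'.S = Nat.card r.P := hs'.card_S
    have h7 : Nat.card (s.comp s').S = Nat.card r.P := (hs.comp hs').card_S
    rw [h5, Nat.card_prod] at h1
    rw [h6, Nat.card_prod] at h2
    rw [h7, Nat.card_prod] at h3
    have p1 : 0 < Nat.card q.P := Nat.card_pos
    have p2 : 0 < Nat.card r.P := Nat.card_pos
    have p3 : 0 < Nat.card H := Nat.card_pos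
    refine Nat.eq_of_mul_eq_mul_right (Nat.mul_pos (Nat.mul_pos p1 p2) p3) ?_
    calc _ = (Nat.card (s.proj.comp s'.proj).X * Nat.card H) * (Nat.card q.P * Nat.card r.P) := by
          ring
      _ = (Nat.card q.P * s.S.index) * (Nat.card r.P * s'.S.index) := by rw [← hc]; ring
      _ = (Nat.card q.P * q.P.index) * (Nat.card r.P * (s.comp s').S.index) * Nat.card H := by
          rw [h1, h2, h3, h4]; ring
      _ = _ := by ring

theorem secComp_cls {p : CommPair G} {q : CommPair H} {r : CommPair J}
    {s : GroupSection (G × H)} {s' : GroupSection (H × J)}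
    (hs : HasInvariants p q s) (hs' : HasInvariants q r s') :
    secComp s.cls s'.cls = q.P.index • (s.comp s').cls := by
  refine Subtype.ext ?_
  change sliceComp (sliceClass s.proj) (sliceClass s'.proj) = _
  rw [sliceComp_sliceClass, sliceClass_comp_proj hs hs']
  rfl

theorem secOpp_cls (s : GroupSection (G × H)) : secOpp s.cls = s.swap.cls := by
  refine Subtype.ext ?_
  have h1 : sliceOpp (sliceClass s.proj) = sliceClass s.proj.opp :=
    FreeAbelianGroup.lift_apply_of (β := SliceBurnside (H × G)) _ (⟦s.proj⟧ : MorClass (G × H))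
  refine h1.trans (sliceClass_eq_of_iso ?_).symm
  have trans : ∀ (U : Subgroup (G × H)) (y : Opp G H ((G × H) ⧸ U)),
      ∃ g : H × G, g • (show Opp G H ((G × H) ⧸ U) from QuotientGroup.mk (1 : G × H)) = y := by
    rintro U ⟨a⟩
    exact ⟨(a.2, a.1), congrArg (QuotientGroup.mk (s := U)) (mul_one a)⟩
  refine proj_iso s.swap s.proj.opp (show (G × H) ⧸ s.S from QuotientGroup.mk (1 : G × H))
    (fun g => ?_) (fun g => ?_) (trans s.S) (trans s.T)
  · refine (smul_mk_eq_mk_iff (g := ((g.2, g.1) : G × H)) (U := s.S) (a := 1) (b := 1)).trans ?_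
    rw [inv_one, one_mul, mul_one, GroupSection.mem_swap_S]
  · refine (smul_mk_eq_mk_iff (g := ((g.2, g.1) : G × H)) (U := s.T) (a := 1) (b := 1)).trans ?_
    rw [inv_one, one_mul, mul_one, GroupSection.mem_swap_T]

variable {k : Type w} [Field k]

theorem linComp_tmul_cls {p : CommPair G} {q : CommPair H} {r : CommPair J}
    {s : GroupSection (G × H)} {s' : GroupSection (H × J)}
    (hs : HasInvariants p q s) (hs' : HasInvariants q r s') (c d : k) :
    linComp (c ⊗ₜ[ℤ] s.cls : LinHom k G H) (d ⊗ₜ[ℤ] s'.cls) =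
      (c * d * q.P.index) ⊗ₜ[ℤ] (s.comp s').cls := by
  rw [linComp, TensorProduct.map₂_apply_tmul, TensorProduct.map_tmul, secComp_cls hs hs',
    LinearMap.mul_apply', ← natCast_zsmul, ← TensorProduct.smul_tmul, natCast_zsmul,
    nsmul_eq_mul, mul_comm]

theorem linOpp_tmul_cls (s : GroupSection (G × H)) (c : k) :
    linOpp (c ⊗ₜ[ℤ] s.cls : LinHom k G H) = c ⊗ₜ[ℤ] s.swap.cls :=
  (LinearMap.lTensor_tmul _ _ _ _).trans (congrArg (c ⊗ₜ[ℤ] ·) (secOpp_cls s))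

end Product

/-! ### Marks separate classes of sections -/

section Marks

variable {G : Type u} [Group G]

/-- The number of points of `X` that are fixed by `S` and lie over points fixed by `T`. -/
def FinMor.mark (s : GroupSection G) (f : FinMor G) : ℤ :=
  Nat.card {x : f.X // (∀ g ∈ s.S, g • x = x) ∧ ∀ g ∈ s.T, g • f.map x = f.map x}

theorem FinMor.mark_eq_of_iso (s : GroupSection G) {f f' : FinMor G} (h : f.Iso f') :
    f.mark s = f'.mark s := by
  obtain ⟨α, β, hα, hβ, h⟩ := h
  refine congrArg Nat.cast (Nat.card_congr (α.subtypeEquiv fun x => ?_))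
  simp only [← hα, h, ← hβ, α.injective.eq_iff, β.injective.eq_iff]

/-- The additive map on the slice Burnside group given by a mark. -/
def markHom (s : GroupSection G) : SliceBurnside G →+ ℤ :=
  QuotientAddGroup.lift _ (FreeAbelianGroup.lift (Quotient.lift (FinMor.mark s)
    fun _ _ h => FinMor.mark_eq_of_iso s h)) (by
    rw [AddSubgroup.closure_le]
    rintro _ ⟨X₁, X₂, Y, _, _, _, _, _, _, f₁, f₂, rfl⟩
    rw [SetLike.mem_coe, AddMonoidHom.mem_ker, map_sub, map_sub, FreeAbelianGroup.lift_apply_of,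
      FreeAbelianGroup.lift_apply_of, FreeAbelianGroup.lift_apply_of, sub_sub, sub_eq_zero]
    simp only [Quotient.lift_mk, FinMor.mark]
    rw [← Nat.cast_add, ← Nat.card_sum]
    refine congrArg Nat.cast (Nat.card_congr (Equiv.subtypeSum.trans (Equiv.sumCongr ?_ ?_)))
    · refine Equiv.subtypeEquivRight fun x => and_congr ?_ ?_
      · exact forall₂_congr fun g _ => Sum.inl_injective.eq_iff (b := x) (a := g • x)
      · exact forall₂_congr fun g _ => ⟨fun e => Subtype.ext e, fun e => congrArg Subtype.val e⟩
    · refine Equiv.subtypeEquivRight fun x => and_congr ?_ ?_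
      · exact forall₂_congr fun g _ => Sum.inr_injective.eq_iff (b := x) (a := g • x)
      · exact forall₂_congr fun g _ => ⟨fun e => Subtype.ext e, fun e => congrArg Subtype.val e⟩)

theorem markHom_sliceClass (s : GroupSection G) (f : FinMor G) :
    markHom s (sliceClass f) = f.mark s :=
  FreeAbelianGroup.lift_apply_of _ (⟦f⟧ : MorClass G)

variable [Finite G]

theorem mark_proj_self_ne_zero (s : GroupSection G) : s.proj.mark s ≠ 0 := by
  rw [FinMor.mark, Nat.cast_ne_zero, ← Nat.pos_iff_ne_zero, Finite.card_pos_iff]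
  refine ⟨⟨QuotientGroup.mk (1 : G), fun g hg => ?_, fun g hg => ?_⟩⟩
  · exact (smul_mk_eq_mk_iff (U := s.S)).2 (by simpa using hg)
  · exact (smul_mk_eq_mk_iff (U := s.T)).2 (by simpa using hg)

theorem exists_conj_of_mark_ne_zero {s s' : GroupSection G} (h : s'.proj.mark s ≠ 0) :
    ∃ g : G, (∀ x ∈ s.S, g⁻¹ * x * g ∈ s'.S) ∧ ∀ x ∈ s.T, g⁻¹ * x * g ∈ s'.T := by
  rw [FinMor.mark, Nat.cast_ne_zero, ← Nat.pos_iff_ne_zero, Finite.card_pos_iff] at h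
  obtain ⟨⟨⟨g⟩, h1, h2⟩⟩ := h
  refine ⟨g, fun x hx => ?_, fun x hx => ?_⟩
  · rw [mul_assoc]
    exact (smul_mk_eq_mk_iff (U := s'.S)).1 (h1 x hx)
  · rw [mul_assoc]
    exact (smul_mk_eq_mk_iff (U := s'.T)).1 (h2 x hx)

variable {k : Type w} [Field k] [CharZero k]

/-- Classes of sections can be separated after tensoring with `k`: the mark of `s` extends to
`kΓ(G, H) → k`, and characteristic zero keeps its nonzero value on the class of `s` nonzero. -/
theorem exists_conj_of_tmul_cls_eq {H : Type u} [Group H] [Finite H] {s s' : GroupSection (G × H)}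
    {c : k} (hc : c ≠ 0) (h : (c ⊗ₜ[ℤ] s.cls : LinHom k G H) = c ⊗ₜ[ℤ] s'.cls) :
    ∃ g : G × H, (∀ x ∈ s.S, g⁻¹ * x * g ∈ s'.S) ∧ ∀ x ∈ s.T, g⁻¹ * x * g ∈ s'.T := by
  let m : SecHom G H →ₗ[ℤ] ℤ := ((markHom s).comp (sectionBurnside (G × H)).subtype).toIntLinearMap
  have h1 := congrArg ((TensorProduct.rid ℤ k) ∘ (m.lTensor k)) h
  simp only [Function.comp_apply, LinearMap.lTensor_tmul, TensorProduct.rid_tmul, zsmul_eq_mul]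
    at h1
  have h2 := Int.cast_injective (mul_right_cancel₀ hc h1)
  have h3 : markHom s (sliceClass s.proj) = markHom s (sliceClass s'.proj) := h2
  rw [markHom_sliceClass, markHom_sliceClass] at h3
  exact exists_conj_of_mark_ne_zero (h3 ▸ mark_proj_self_ne_zero s)

end Marks

/-! ### Bitorsors and the equivalences they induce -/

section Bitorsor

/-- An `(A, B)`-biset on which both groups act simply transitively. -/
class IsBitorsor (A B X : Type*) [Group A] [Group B] [MulAction A X] [MulAction Bᵐᵒᵖ X] :
    Prop where
  nonempty : Nonempty X
  left_trans : MulAction.IsPretransitive A X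
  right_trans : MulAction.IsPretransitive Bᵐᵒᵖ X
  left_free : ∀ (a : A) (x : X), a • x = x → a = 1
  right_free : ∀ (b : B) (x : X), MulOpposite.op b • x = x → b = 1

variable {A B X : Type v} [Group A] [Group B] [MulAction A X] [MulAction Bᵐᵒᵖ X]

variable (A B) in
theorem IsBitorsor.left_cancel [IsBitorsor A B X] {a a' : A} {x : X} (h : a • x = a' • x) :
    a = a' := by
  refine (inv_mul_eq_one.1 (left_free B (a'⁻¹ * a) x ?_)).symm
  rw [mul_smul, h, inv_smul_smul]

variable (A B) in
theorem IsBitorsor.right_cancel [IsBitorsor A B X] {b b' : B} {x : X}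
    (h : MulOpposite.op b • x = MulOpposite.op b' • x) : b = b' := by
  refine mul_inv_eq_one.1 (right_free A (b * b'⁻¹) x ?_)
  rw [MulOpposite.op_mul, mul_smul, h, MulOpposite.op_inv, inv_smul_smul]

/-- A point `x` of a bitorsor identifies the two groups, through `φ(b) x = x b`. -/
theorem IsBitorsor.existsUnique_mulEquiv [SMulCommClass A Bᵐᵒᵖ X] [IsBitorsor A B X] (x : X) :
    ∃! φ : B ≃* A, ∀ b : B, φ b • x = MulOpposite.op b • x := by
  have lt : MulAction.IsPretransitive A X := left_trans B
  have rt : MulAction.IsPretransitive Bᵐᵒᵖ X := right_trans A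
  choose φ hφ using fun b : B => MulAction.exists_smul_eq A x (MulOpposite.op b • x)
  have hmul : ∀ b b', φ (b * b') = φ b * φ b' := fun b b' => by
    refine left_cancel A B (x := x) ?_
    rw [hφ, mul_smul, hφ b', smul_comm, hφ b, MulOpposite.op_mul, mul_smul]
  refine ⟨MulEquiv.ofBijective (MonoidHom.mk' φ hmul) ⟨fun b b' h => ?_, fun a => ?_⟩, hφ,
    fun ψ hψ => MulEquiv.ext fun b => left_cancel A B (x := x) ((hψ b).trans (hφ b).symm)⟩
  · refine right_cancel A B (x := x) ?_
    rw [← hφ, ← hφ]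
    exact congrArg (· • x) h
  · obtain ⟨b, hb⟩ := MulAction.exists_smul_eq Bᵐᵒᵖ x (a • x)
    exact ⟨b.unop, left_cancel A B (x := x) ((hφ b.unop).trans hb)⟩

open CategoryTheory

variable (k : Type u) [Field k]

section Coordinates

variable {k} {φ : B ≃* A} {x₀ : X} {β : X → B}

variable (k β) in
/-- The map `k[X] → kB` induced by a map `X → B`. -/
def PermModule.coord : PermModule k X →+ MonoidAlgebra k B :=
  Finsupp.liftAddHom fun x => MonoidAlgebra.singleAddHom (β x)

theorem PermModule.coord_single {B X : Type v} {β : X → B} (x : X) (c : k) :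
    PermModule.coord k β (PermModule.single x c) = MonoidAlgebra.single (β x) c :=
  Finsupp.liftAddHom_apply_single _ x c

theorem PermModule.single_smul_single (a : A) (c d : k) (x : X) :
    MonoidAlgebra.single a c • PermModule.single x d = PermModule.single (a • x) (c * d) :=
  PermModule.leftHom_single k X a c d x

theorem PermModule.op_single_smul_single (b : B) (c d : k) (x : X) :
    MulOpposite.op (MonoidAlgebra.single b c) • PermModule.single x d =
      PermModule.single (MulOpposite.op b • x) (c * d) :=
  PermModule.rightHom_single k X b c d x

theorem PermModule.coord_smul {A B X : Type v} [Group A] [Group B] [MulAction A X] {φ : B ≃* A}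
    {β : X → B} (hβ : ∀ (a : A) x, β (a • x) = φ.symm a * β x)
    (a : MonoidAlgebra k A) (ξ : PermModule k X) :
    coord k β (a • ξ) = MonoidAlgebra.domCongr k k φ.symm a * coord k β ξ := by
  induction a using MonoidAlgebra.induction_linear with
  | zero => simp
  | add a a' h h' => rw [add_smul, map_add, h, h', map_add, add_mul]
  | single a c =>
    induction ξ using PermModule.induction with
    | h0 => simp
    | hadd y z hy hz => rw [smul_add, map_add, hy, hz, map_add, mul_add]
    | hs x d =>
      rw [single_smul_single, coord_single, coord_single, MonoidAlgebra.domCongr_single,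
        MonoidAlgebra.single_mul_single, hβ]

theorem PermModule.coord_op_smul (hβ : ∀ (b : B) x, β (MulOpposite.op b • x) = β x * b)
    (b : MonoidAlgebra k B) (ξ : PermModule k X) :
    coord k β (MulOpposite.op b • ξ) = coord k β ξ * b := by
  induction b using MonoidAlgebra.induction_linear with
  | zero => simp
  | add a a' h h' => rw [MulOpposite.op_add, add_smul, map_add, h, h', mul_add]
  | single b c =>
    induction ξ using PermModule.induction with
    | h0 => simp
    | hadd y z hy hz => rw [smul_add, map_add, hy, hz, map_add, add_mul]
    | hs x d =>
      rw [op_single_smul_single, coord_single, coord_single, MonoidAlgebra.single_mul_single, hβ,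
        mul_comm c d]

variable (k φ) in
/-- Restriction of modules along the isomorphism `kA ≃ kB` given by `φ⁻¹`. -/
abbrev restrictAlong : ModuleCat.{max u v} (MonoidAlgebra k B) ⥤
    ModuleCat.{max u v} (MonoidAlgebra k A) :=
  ModuleCat.restrictScalars (MonoidAlgebra.domCongr k k φ.symm).toRingEquiv.toRingHom

/-- The map `k[X] ⊗_{kB} M → M`, `x ⊗ m ↦ β(x) m`.  Here `β(x)` is the coordinate of `x` with
respect to a base point `x₀`, that is `x = x₀ β(x)`; the hypotheses say how it transforms. -/
def contract (hβ : ∀ (a : A) x, β (a • x) = φ.symm a * β x)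
    (hβ' : ∀ (b : B) x, β (MulOpposite.op b • x) = β x * b)
    (M : ModuleCat.{max u v} (MonoidAlgebra k B)) :
    BalancedTensor (MonoidAlgebra k A) (MonoidAlgebra k B) (PermModule k X) M →ₗ[MonoidAlgebra k A]
      (restrictAlong k φ).obj M :=
  let t : PermModule k X ⊗[ℤ] M →ₗ[ℤ] M := TensorProduct.lift
    (LinearMap.mk₂ ℤ (fun ξ m => PermModule.coord k β ξ • m)
      (fun ξ ξ' m => by rw [map_add, add_smul]) (fun n ξ m => by rw [map_zsmul, smul_assoc])
      (fun ξ m m' => smul_add _ _ _) (fun n ξ m => smul_comm _ _ _))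
  let t' : PermModule k X ⊗[ℤ] M →ₗ[MonoidAlgebra k A] (restrictAlong k φ).obj M :=
    { toFun := t
      map_add' := map_add t
      map_smul' := fun a z => by
        induction z using TensorProduct.induction_on with
        | zero =>
          rw [smul_zero, map_zero]
          exact (smul_zero (A := M) (MonoidAlgebra.domCongr k k φ.symm a)).symm
        | tmul ξ m =>
          refine (congrArg (· • m) (PermModule.coord_smul (k := k) hβ a ξ)).trans ?_
          exact mul_smul (MonoidAlgebra.domCongr k k φ.symm a) (PermModule.coord k β ξ) m
        | add y z hy hz =>
          rw [smul_add, map_add, map_add, hy, hz]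
          exact (smul_add (MonoidAlgebra.domCongr k k φ.symm a) (t y) (t z)).symm }
  Submodule.liftQ _ t' (by
    rw [balancedRel, Submodule.span_le]
    rintro _ ⟨ξ, b, m, rfl⟩
    refine LinearMap.mem_ker.2 ?_
    rw [map_sub]
    refine sub_eq_zero.2 ?_
    change PermModule.coord k β _ • m = PermModule.coord k β _ • b • m
    rw [PermModule.coord_op_smul hβ', mul_smul])

theorem contract_mk_tmul (hβ : ∀ (a : A) x, β (a • x) = φ.symm a * β x)
    (hβ' : ∀ (b : B) x, β (MulOpposite.op b • x) = β x * b)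
    (M : ModuleCat.{max u v} (MonoidAlgebra k B)) (ξ : PermModule k X) (m : M) :
    contract hβ hβ' M (Submodule.Quotient.mk (ξ ⊗ₜ m)) = (PermModule.coord k β ξ • m : M) := rfl

theorem BalancedTensor.induction {M : Type*} [AddCommGroup M] [Module (MonoidAlgebra k B) M]
    {P : BalancedTensor (MonoidAlgebra k A) (MonoidAlgebra k B) (PermModule k X) M → Prop}
    (z : BalancedTensor (MonoidAlgebra k A) (MonoidAlgebra k B) (PermModule k X) M) (h0 : P 0)
    (hadd : ∀ y z, P y → P z → P (y + z))
    (ht : ∀ ξ m, P (Submodule.Quotient.mk (ξ ⊗ₜ m))) : P z := by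
  obtain ⟨z, rfl⟩ := Submodule.Quotient.mk_surjective _ z
  induction z using TensorProduct.induction_on with
  | zero => exact h0
  | tmul ξ m => exact ht ξ m
  | add y z hy hz => exact hadd _ _ hy hz

/-- The inverse of the contraction is `m ↦ x₀ ⊗ m`. -/
theorem contract_bijective (hβ : ∀ (a : A) x, β (a • x) = φ.symm a * β x)
    (hβ' : ∀ (b : B) x, β (MulOpposite.op b • x) = β x * b)
    (h₀ : ∀ x, MulOpposite.op (β x) • x₀ = x) (h₁ : β x₀ = 1)
    (M : ModuleCat.{max u v} (MonoidAlgebra k B)) : Function.Bijective (contract hβ hβ' M) := by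
  let ι : M →+ BalancedTensor (MonoidAlgebra k A) (MonoidAlgebra k B) (PermModule k X) M :=
    { toFun := fun m => Submodule.Quotient.mk (PermModule.single x₀ 1 ⊗ₜ m)
      map_zero' := by rw [TensorProduct.tmul_zero]; rfl
      map_add' := fun m m' => by rw [TensorProduct.tmul_add]; rfl }
  refine Function.bijective_iff_has_inverse.2 ⟨ι, fun z => ?_, fun m => ?_⟩
  · induction z using BalancedTensor.induction with
    | h0 => rw [map_zero]; exact map_zero ι
    | hadd y z hy hz => rw [map_add]; exact (map_add ι _ _).trans (congrArg₂ (· + ·) hy hz)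
    | ht ξ m =>
      rw [contract_mk_tmul]
      induction ξ using PermModule.induction with
      | h0 => rw [map_zero, zero_smul, map_zero, TensorProduct.zero_tmul]; rfl
      | hadd y z hy hz =>
        rw [map_add, add_smul, map_add, hy, hz, TensorProduct.add_tmul]; rfl
      | hs x d =>
        rw [PermModule.coord_single]
        have hmem : (MulOpposite.op (MonoidAlgebra.single (β x) d) •
            (PermModule.single x₀ 1 : PermModule k X)) ⊗ₜ[ℤ] m -
              PermModule.single x₀ 1 ⊗ₜ[ℤ] (MonoidAlgebra.single (β x) d • m) ∈
            balancedRel (MonoidAlgebra k A) (MonoidAlgebra k B) (PermModule k X) M :=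
          Submodule.subset_span ⟨_, _, _, rfl⟩
        rw [PermModule.op_single_smul_single, h₀, mul_one] at hmem
        exact ((Submodule.Quotient.eq _).2 hmem).symm
  · refine (contract_mk_tmul hβ hβ' M _ m).trans ?_
    rw [PermModule.coord_single, h₁]
    exact one_smul (MonoidAlgebra k B) m

theorem contract_map (hβ : ∀ (a : A) x, β (a • x) = φ.symm a * β x)
    (hβ' : ∀ (b : B) x, β (MulOpposite.op b • x) = β x * b)
    {M N : ModuleCat.{max u v} (MonoidAlgebra k B)} (f : M ⟶ N)
    (z : BalancedTensor (MonoidAlgebra k A) (MonoidAlgebra k B) (PermModule k X) M) :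
    contract hβ hβ' N (BalancedTensor.map _ _ _ f.hom z) = f.hom (contract hβ hβ' M z) := by
  induction z using BalancedTensor.induction with
  | h0 => rw [map_zero, map_zero, map_zero]; exact (map_zero f.hom).symm
  | hadd y z hy hz =>
    rw [map_add, map_add, map_add, hy, hz]
    exact (map_add f.hom (contract hβ hβ' M y : M) (contract hβ hβ' M z : M)).symm
  | ht ξ m => exact (map_smul f.hom (PermModule.coord k β ξ) m).symm

variable [SMulCommClass A Bᵐᵒᵖ X]

/-- In terms of coordinates on `X`, the functor `k[X] ⊗_{kB} -` is restriction along `kA ≃ kB`. -/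
def bisetFunctorIso (hβ : ∀ (a : A) x, β (a • x) = φ.symm a * β x)
    (hβ' : ∀ (b : B) x, β (MulOpposite.op b • x) = β x * b)
    (h₀ : ∀ x, MulOpposite.op (β x) • x₀ = x) (h₁ : β x₀ = 1) :
    bisetFunctor k A B X ≅ restrictAlong k φ :=
  NatIso.ofComponents (fun M => (LinearEquiv.ofBijective (contract hβ hβ' M)
      (contract_bijective hβ hβ' h₀ h₁ M)).toModuleIso) (fun f =>
    ModuleCat.hom_ext (LinearMap.ext fun z => contract_map hβ hβ' f z))

end Coordinates

variable [SMulCommClass A Bᵐᵒᵖ X]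

/-- For a bitorsor, `k[X] ⊗_{kB} -` is isomorphic to restriction along an isomorphism of group
algebras. -/
theorem IsBitorsor.exists_bisetFunctor_iso [IsBitorsor A B X] :
    ∃ φ : B ≃* A, Nonempty (bisetFunctor k A B X ≅ restrictAlong k φ) := by
  have rt : MulAction.IsPretransitive Bᵐᵒᵖ X := right_trans A
  obtain ⟨x₀⟩ : Nonempty X := nonempty A B
  obtain ⟨φ, hφ, -⟩ := existsUnique_mulEquiv (A := A) (B := B) x₀
  choose β hβ using fun x => MulAction.exists_smul_eq Bᵐᵒᵖ x₀ x
  refine ⟨φ, ⟨bisetFunctorIso (β := fun x => (β x).unop) (x₀ := x₀) (fun a x => ?_)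
    (fun b x => ?_) hβ ?_⟩⟩
  · refine right_cancel A B (x := x₀) ?_
    rw [MulOpposite.op_mul, mul_smul, ← hφ (φ.symm a), MulEquiv.apply_symm_apply,
      MulOpposite.op_unop, MulOpposite.op_unop, hβ, ← smul_comm, hβ]
  · refine right_cancel A B (x := x₀) ?_
    rw [MulOpposite.op_mul, mul_smul, MulOpposite.op_unop, MulOpposite.op_unop, hβ, hβ]
  · refine right_cancel A B (x := x₀) ?_
    rw [MulOpposite.op_unop, hβ, MulOpposite.op_one, one_smul]

theorem IsBitorsor.isEquivalence_bisetFunctor [IsBitorsor A B X] :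
    (bisetFunctor k A B X).IsEquivalence := by
  obtain ⟨φ, ⟨e⟩⟩ := exists_bisetFunctor_iso (A := A) (B := B) (X := X) k
  have : (restrictAlong k φ).IsEquivalence := ModuleCat.restrictScalars_isEquivalence_of_ringEquiv _
  exact Functor.isEquivalence_of_iso e.symm

/-- The modules `k[X] ⊗_{kB} M` and `M` are semilinearly isomorphic. -/
theorem IsBitorsor.exists_bijective_semilinear [IsBitorsor A B X] :
    ∃ e : MonoidAlgebra k A ≃+* MonoidAlgebra k B, ∀ M : ModuleCat.{max u v} (MonoidAlgebra k B),
      ∃ l : (bisetFunctor k A B X).obj M →ₛₗ[(e : MonoidAlgebra k A →+* MonoidAlgebra k B)] M,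
        Function.Bijective l := by
  obtain ⟨φ, ⟨e⟩⟩ := exists_bisetFunctor_iso (A := A) (B := B) (X := X) k
  refine ⟨(MonoidAlgebra.domCongr k k φ.symm).toRingEquiv, fun M => ⟨
    { toFun := (e.app M).toLinearEquiv
      map_add' := map_add (e.app M).toLinearEquiv
      map_smul' := fun a z => map_smul (e.app M).toLinearEquiv a z }, ?_⟩⟩
  exact (e.app M).toLinearEquiv.bijective

theorem IsBitorsor.finite_bisetFunctor_iff [IsBitorsor A B X]
    (M : ModuleCat.{max u v} (MonoidAlgebra k B)) :
    Module.Finite (MonoidAlgebra k A) ((bisetFunctor k A B X).obj M) ↔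
      Module.Finite (MonoidAlgebra k B) M := by
  obtain ⟨e, h⟩ := exists_bijective_semilinear (A := A) (B := B) (X := X) k
  obtain ⟨l, hl⟩ := h M
  exact LinearMap.finite_iff_of_bijective l hl

theorem IsBitorsor.isSimpleModule_bisetFunctor_iff [IsBitorsor A B X]
    (M : ModuleCat.{max u v} (MonoidAlgebra k B)) :
    IsSimpleModule (MonoidAlgebra k A) ((bisetFunctor k A B X).obj M) ↔
      IsSimpleModule (MonoidAlgebra k B) M := by
  obtain ⟨e, h⟩ := exists_bijective_semilinear (A := A) (B := B) (X := X) k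
  obtain ⟨l, hl⟩ := h M
  exact LinearMap.isSimpleModule_iff_of_bijective l hl

/-- An equivalence of module categories preserving and reflecting simplicity induces a bijection on
isomorphism classes of simple modules. -/
theorem exists_irr_equiv {R S : Type w} [Ring R] [Ring S]
    (F : ModuleCat.{v} R ⥤ ModuleCat.{v} S) [F.IsEquivalence]
    (hF : ∀ M, IsSimpleModule S (F.obj M) ↔ IsSimpleModule R M) :
    ∃ Φ : Irr.{w, v} R ≃ Irr.{w, v} S, ∀ (M : ModuleCat.{v} R) (hM : IsSimpleModule R M),
      ∃ hS : IsSimpleModule S (F.obj M), Φ (Irr.mk M hM) = Irr.mk (F.obj M) hS := by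
  let Ψ : Irr.{w, v} R → Irr.{w, v} S := Quotient.map
    (fun M => ⟨F.obj M.1, (hF M.1).2 M.2⟩) (fun M N ⟨e⟩ => ⟨F.mapIso e⟩)
  refine ⟨Equiv.ofBijective Ψ ⟨?_, ?_⟩, fun M hM => ⟨(hF M).2 hM, rfl⟩⟩
  · rintro ⟨M⟩ ⟨N⟩ h
    obtain ⟨e⟩ := Quotient.exact h
    exact Quotient.sound ⟨F.preimageIso e⟩
  · rintro ⟨N, hN⟩
    have e : F.obj (F.objPreimage N) ≅ N := F.objObjPreimageIso N
    have hS : IsSimpleModule S (F.obj (F.objPreimage N)) := IsSimpleModule.congr e.toLinearEquiv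
    exact ⟨Irr.mk (F.objPreimage N) ((hF _).1 hS), Quotient.sound ⟨e⟩⟩

end Bitorsor

/-! ### The groups and bisets of classes of sections -/

section GammaGroup

variable {k : Type w} [Field k] {G H : Type u} [Group G] [Group H] [Finite G] [Finite H]
  {p : CommPair G} {q : CommPair H}

variable (k) in
/-- The element `|G : P|⁻¹ [T, S]` of `Γ_{(G,K,P)}`. -/
def Gam.mk (s : GroupSection (G × G)) (hs : HasInvariants p p s) : Gam k p :=
  ⟨(p.P.index : k)⁻¹ ⊗ₜ[ℤ] s.cls, s, hs, rfl⟩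

variable (k) in
/-- The element `[V, U]` of `_{(G,K,P)}Γ_{(H,L,Q)}`. -/
def GamBi.mk (s : GroupSection (G × H)) (hs : HasInvariants p q s) : GamBi k p q :=
  ⟨(1 : k) ⊗ₜ[ℤ] s.cls, s, hs, rfl⟩

theorem Gam.exists_mk (a : Gam k p) : ∃ s, ∃ hs : HasInvariants p p s, a = Gam.mk k s hs := by
  obtain ⟨_, s, hs, rfl⟩ := a
  exact ⟨s, hs, rfl⟩

theorem GamBi.exists_mk (x : GamBi k p q) :
    ∃ s, ∃ hs : HasInvariants p q s, x = GamBi.mk k s hs := by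
  obtain ⟨_, s, hs, rfl⟩ := x
  exact ⟨s, hs, rfl⟩

theorem Gam.mk_congr {s s' : GroupSection (G × G)} {hs : HasInvariants p p s}
    {hs' : HasInvariants p p s'} (h : s = s') : Gam.mk k s hs = Gam.mk k s' hs' := by
  subst h
  rfl

theorem GamBi.mk_congr {s s' : GroupSection (G × H)} {hs : HasInvariants p q s}
    {hs' : HasInvariants p q s'} (h : s = s') : GamBi.mk k s hs = GamBi.mk k s' hs' := by
  subst h
  rfl

/-- The unit `e_{(K,P)}` of `Γ_{(G,K,P)}`. -/
abbrev Gam.instOne : One (Gam k p) := ⟨⟨idem k p, p.diagSection, p.diagSection_hasInvariants, rfl⟩⟩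

attribute [local instance] Gam.instOne

theorem Gam.one_def : (1 : Gam k p) = Gam.mk k p.diagSection p.diagSection_hasInvariants := rfl

/-- Inversion in `Γ_{(G,K,P)}` is taking opposites. -/
abbrev Gam.instInv : Inv (Gam k p) := ⟨fun a => ⟨linOpp a.1, by
  obtain ⟨_, s, hs, rfl⟩ := a
  exact ⟨s.swap, hs.swap, linOpp_tmul_cls s _⟩⟩⟩

attribute [local instance] Gam.instInv

theorem Gam.inv_mk {s : GroupSection (G × G)} (hs : HasInvariants p p s) :
    (Gam.mk k s hs)⁻¹ = Gam.mk k s.swap hs.swap :=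
  Subtype.ext (linOpp_tmul_cls s _)

instance : Finite (GroupSection G) :=
  Finite.of_injective (fun s => (s.T, s.S)) fun s s' h => by
    obtain ⟨h1, h2⟩ := Prod.mk.inj h
    exact GroupSection.ext (fun x => by rw [h1]) (fun x => by rw [h2])

instance : Finite (Gam k p) :=
  Finite.of_surjective (fun s : {s // HasInvariants p p s} => Gam.mk k s.1 s.2) fun a => by
    obtain ⟨s, hs, rfl⟩ := Gam.exists_mk a
    exact ⟨⟨s, hs⟩, rfl⟩

variable [CharZero k]

theorem CommPair.index_ne_zero (p : CommPair G) : (p.P.index : k) ≠ 0 :=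
  Nat.cast_ne_zero.2 p.P.index_ne_zero_of_finite

theorem linComp_gam_mk {s s' : GroupSection (G × G)} (hs : HasInvariants p p s)
    (hs' : HasInvariants p p s') :
    linComp (Gam.mk k s hs).1 (Gam.mk k s' hs').1 = (Gam.mk k (s.comp s') (hs.comp hs')).1 := by
  refine (linComp_tmul_cls hs hs' _ _).trans ?_
  rw [mul_assoc, inv_mul_cancel₀ p.index_ne_zero, mul_one]
  rfl

theorem linComp_gam_mk_gamBi_mk {s : GroupSection (G × G)} {s' : GroupSection (G × H)}
    (hs : HasInvariants p p s) (hs' : HasInvariants p q s') :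
    linComp (Gam.mk k s hs).1 (GamBi.mk k s' hs').1 =
      (GamBi.mk k (s.comp s') (hs.comp hs')).1 := by
  refine (linComp_tmul_cls hs hs' _ _).trans ?_
  rw [mul_one, inv_mul_cancel₀ p.index_ne_zero]
  rfl

theorem linComp_gamBi_mk_gam_mk {s : GroupSection (G × H)} {s' : GroupSection (H × H)}
    (hs : HasInvariants p q s) (hs' : HasInvariants q q s') :
    linComp (GamBi.mk k s hs).1 (Gam.mk k s' hs').1 =
      (GamBi.mk k (s.comp s') (hs.comp hs')).1 := by
  refine (linComp_tmul_cls hs hs' _ _).trans ?_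
  rw [one_mul, inv_mul_cancel₀ q.index_ne_zero]
  rfl

/-- The product of `E_G` restricted to `Γ_{(G,K,P)}`. -/
abbrev Gam.instMul : Mul (Gam k p) := ⟨fun a b => ⟨linComp a.1 b.1, by
  obtain ⟨s, hs, rfl⟩ := Gam.exists_mk a
  obtain ⟨s', hs', rfl⟩ := Gam.exists_mk b
  exact ⟨s.comp s', hs.comp hs', linComp_gam_mk hs hs'⟩⟩⟩

attribute [local instance] Gam.instMul

theorem Gam.mk_mul_mk {s s' : GroupSection (G × G)} (hs : HasInvariants p p s)
    (hs' : HasInvariants p p s') :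
    Gam.mk k s hs * Gam.mk k s' hs' = Gam.mk k (s.comp s') (hs.comp hs') :=
  Subtype.ext (linComp_gam_mk hs hs')

/-- The group `Γ_{(G,K,P)}`. -/
abbrev Gam.group : Group (Gam k p) :=
  Group.ofLeftAxioms
    (fun a b c => by
      obtain ⟨s, hs, rfl⟩ := Gam.exists_mk a
      obtain ⟨s', hs', rfl⟩ := Gam.exists_mk b
      obtain ⟨s'', hs'', rfl⟩ := Gam.exists_mk c
      simp only [Gam.mk_mul_mk]
      exact Gam.mk_congr (s.comp_assoc s' s''))
    (fun a => by
      obtain ⟨s, hs, rfl⟩ := Gam.exists_mk a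
      rw [Gam.one_def, Gam.mk_mul_mk]
      exact Gam.mk_congr hs.diagSection_comp)
    (fun a => by
      obtain ⟨s, hs, rfl⟩ := Gam.exists_mk a
      rw [Gam.one_def, Gam.inv_mk, Gam.mk_mul_mk]
      exact Gam.mk_congr hs.swap_comp)

attribute [local instance] Gam.group

/-- The left product `Γ_{(G,K,P)} × _{(G,K,P)}Γ_{(H,L,Q)} → _{(G,K,P)}Γ_{(H,L,Q)}`. -/
def GamBi.leftMul (a : Gam k p) (x : GamBi k p q) : GamBi k p q :=
  ⟨linComp a.1 x.1, by
    obtain ⟨s, hs, rfl⟩ := Gam.exists_mk a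
    obtain ⟨s', hs', rfl⟩ := GamBi.exists_mk x
    exact ⟨s.comp s', hs.comp hs', linComp_gam_mk_gamBi_mk hs hs'⟩⟩

theorem GamBi.leftMul_mk {s : GroupSection (G × G)} {s' : GroupSection (G × H)}
    (hs : HasInvariants p p s) (hs' : HasInvariants p q s') :
    leftMul (Gam.mk k s hs) (mk k s' hs') = mk k (s.comp s') (hs.comp hs') :=
  Subtype.ext (linComp_gam_mk_gamBi_mk hs hs')

/-- The right product `_{(G,K,P)}Γ_{(H,L,Q)} × Γ_{(H,L,Q)} → _{(G,K,P)}Γ_{(H,L,Q)}`. -/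
def GamBi.rightMul (x : GamBi k p q) (b : Gam k q) : GamBi k p q :=
  ⟨linComp x.1 b.1, by
    obtain ⟨s, hs, rfl⟩ := GamBi.exists_mk x
    obtain ⟨s', hs', rfl⟩ := Gam.exists_mk b
    exact ⟨s.comp s', hs.comp hs', linComp_gamBi_mk_gam_mk hs hs'⟩⟩

theorem GamBi.rightMul_mk {s : GroupSection (G × H)} {s' : GroupSection (H × H)}
    (hs : HasInvariants p q s) (hs' : HasInvariants q q s') :
    rightMul (mk k s hs) (Gam.mk k s' hs') = mk k (s.comp s') (hs.comp hs') :=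
  Subtype.ext (linComp_gamBi_mk_gam_mk hs hs')

/-- The left action of `Γ_{(G,K,P)}` on `_{(G,K,P)}Γ_{(H,L,Q)}`. -/
abbrev GamBi.leftAction : MulAction (Gam k p) (GamBi k p q) where
  smul := leftMul
  one_smul x := by
    obtain ⟨s, hs, rfl⟩ := GamBi.exists_mk x
    exact (leftMul_mk p.diagSection_hasInvariants hs).trans (mk_congr hs.diagSection_comp)
  mul_smul a b x := by
    obtain ⟨s, hs, rfl⟩ := Gam.exists_mk a
    obtain ⟨s', hs', rfl⟩ := Gam.exists_mk b
    obtain ⟨s'', hs'', rfl⟩ := GamBi.exists_mk x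
    change leftMul (_ * _) _ = leftMul _ (leftMul _ _)
    rw [Gam.mk_mul_mk, leftMul_mk, leftMul_mk, leftMul_mk]
    exact mk_congr (s.comp_assoc s' s'')

/-- The right action of `Γ_{(H,L,Q)}` on `_{(G,K,P)}Γ_{(H,L,Q)}`. -/
abbrev GamBi.rightAction : MulAction (Gam k q)ᵐᵒᵖ (GamBi k p q) where
  smul b x := rightMul x b.unop
  one_smul x := by
    obtain ⟨s, hs, rfl⟩ := GamBi.exists_mk x
    exact (rightMul_mk hs q.diagSection_hasInvariants).trans (mk_congr hs.comp_diagSection)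
  mul_smul a b x := by
    obtain ⟨a, rfl⟩ := MulOpposite.op_surjective a
    obtain ⟨b, rfl⟩ := MulOpposite.op_surjective b
    obtain ⟨s, hs, rfl⟩ := Gam.exists_mk a
    obtain ⟨s', hs', rfl⟩ := Gam.exists_mk b
    obtain ⟨s'', hs'', rfl⟩ := GamBi.exists_mk x
    change rightMul _ (_ * _) = rightMul (rightMul _ _) _
    rw [MulOpposite.unop_op, MulOpposite.unop_op, Gam.mk_mul_mk, rightMul_mk, rightMul_mk,
      rightMul_mk]
    exact mk_congr (s''.comp_assoc s' s).symm

attribute [local instance] GamBi.leftAction GamBi.rightAction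

theorem Gam.mk_smul_mk {s : GroupSection (G × G)} {s' : GroupSection (G × H)}
    (hs : HasInvariants p p s) (hs' : HasInvariants p q s') :
    Gam.mk k s hs • GamBi.mk k s' hs' = GamBi.mk k (s.comp s') (hs.comp hs') :=
  GamBi.leftMul_mk hs hs'

theorem Gam.op_mk_smul_mk {s : GroupSection (G × H)} {s' : GroupSection (H × H)}
    (hs : HasInvariants p q s) (hs' : HasInvariants q q s') :
    MulOpposite.op (Gam.mk k s' hs') • GamBi.mk k s hs = GamBi.mk k (s.comp s') (hs.comp hs') :=
  GamBi.rightMul_mk hs hs'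

theorem GamBi.smulCommClass : SMulCommClass (Gam k p) (Gam k q)ᵐᵒᵖ (GamBi k p q) where
  smul_comm a b x := by
    obtain ⟨b, rfl⟩ := MulOpposite.op_surjective b
    obtain ⟨s, hs, rfl⟩ := Gam.exists_mk a
    obtain ⟨s', hs', rfl⟩ := Gam.exists_mk b
    obtain ⟨s'', hs'', rfl⟩ := GamBi.exists_mk x
    simp only [Gam.mk_smul_mk, Gam.op_mk_smul_mk]
    exact GamBi.mk_congr (s.comp_assoc s'' s').symm

attribute [local instance] GamBi.smulCommClass

/-- Transitivity and freeness come from the inverse `s.swap` of a section `s`: `s'` is carried to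
`s` by `s * s'.swap`, and composing with `s.swap` cancels `s`. -/
theorem isBitorsor_gamBi (hpq : Linked p q) : IsBitorsor (Gam k p) (Gam k q) (GamBi k p q) where
  nonempty := by
    obtain ⟨s, hs⟩ := hpq
    exact ⟨GamBi.mk k s hs⟩
  left_trans := ⟨fun x y => by
    obtain ⟨s, hs, rfl⟩ := GamBi.exists_mk x
    obtain ⟨s', hs', rfl⟩ := GamBi.exists_mk y
    refine ⟨Gam.mk k (s'.comp s.swap) (hs'.comp hs.swap), ?_⟩
    rw [Gam.mk_smul_mk]
    refine GamBi.mk_congr ?_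
    rw [GroupSection.comp_assoc, hs.swap_comp, hs'.comp_diagSection]⟩
  right_trans := ⟨fun x y => by
    obtain ⟨s, hs, rfl⟩ := GamBi.exists_mk x
    obtain ⟨s', hs', rfl⟩ := GamBi.exists_mk y
    refine ⟨MulOpposite.op (Gam.mk k (s.swap.comp s') (hs.swap.comp hs')), ?_⟩
    rw [Gam.op_mk_smul_mk]
    refine GamBi.mk_congr ?_
    rw [← GroupSection.comp_assoc, hs.comp_swap, hs'.diagSection_comp]⟩
  left_free a x h := by
    obtain ⟨s, hs, rfl⟩ := Gam.exists_mk a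
    obtain ⟨s', hs', rfl⟩ := GamBi.exists_mk x
    rw [Gam.mk_smul_mk] at h
    -- Multiply `[s s'] = [s']` on the right by `[s'.swap]`, scaled so that the outcome
    -- `[s] = [diagonal]` carries the coefficient `|G : P|⁻¹`.
    have h1 := congrArg (fun z : GamBi k p q =>
      linComp z.1 ((((q.P.index : k)⁻¹ * (p.P.index : k)⁻¹) ⊗ₜ[ℤ] s'.swap.cls : LinHom k H G))) h
    have h2 := (linComp_tmul_cls (hs.comp hs') hs'.swap _ _).symm.trans
      (h1.trans (linComp_tmul_cls hs' hs'.swap _ _))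
    have h3 : (1 : k) * ((q.P.index : k)⁻¹ * (p.P.index : k)⁻¹) * (q.P.index : k) =
        (p.P.index : k)⁻¹ := by
      have := q.index_ne_zero (k := k)
      field_simp
    rw [h3, GroupSection.comp_assoc, hs'.comp_swap, hs.comp_diagSection] at h2
    exact Subtype.ext h2
  right_free b x h := by
    obtain ⟨s, hs, rfl⟩ := Gam.exists_mk b
    obtain ⟨s', hs', rfl⟩ := GamBi.exists_mk x
    rw [Gam.op_mk_smul_mk] at h
    have h1 := congrArg (fun z : GamBi k p q =>
      linComp ((((p.P.index : k)⁻¹ * (q.P.index : k)⁻¹) ⊗ₜ[ℤ] s'.swap.cls : LinHom k H G)) z.1) h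
    have h2 := (linComp_tmul_cls hs'.swap (hs'.comp hs) _ _).symm.trans
      (h1.trans (linComp_tmul_cls hs'.swap hs' _ _))
    have h3 : ((p.P.index : k)⁻¹ * (q.P.index : k)⁻¹) * (1 : k) * (p.P.index : k) =
        (q.P.index : k)⁻¹ := by
      have := p.index_ne_zero (k := k)
      field_simp
    rw [h3, ← GroupSection.comp_assoc, hs'.swap_comp, hs.diagSection_comp] at h2
    exact Subtype.ext h2

end GammaGroup

/-! ### Outer automorphisms of the crossed module -/

section OuterAut

variable {G : Type u} [Group G] {p : CommPair G}

namespace CommPair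

theorem coe_crossed_act (g : G) (y : p.P) :
    ((p.crossed.act (QuotientGroup.mk g) y : p.P) : G) = g * y * g⁻¹ :=
  MulAut.conjNormal_apply g y

theorem crossed_bd (y : p.P) : p.crossed.bd y = QuotientGroup.mk (y : G) := rfl

/-- The section of `G × G` formed by the graphs of an automorphism `(α, β)` of `(P, G/K, i_P)`:
`T = {(g, h) | gK = β(hK)}` and `S = {(α(y), y) | y ∈ P}`. -/
def autSection (x : p.crossed.aut) : GroupSection (G × G) :=
  GroupSection.ofConj
    (((QuotientGroup.mk' p.K).comp (MonoidHom.fst G G)).eqLocus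
      (x.1.2.toMonoidHom.comp ((QuotientGroup.mk' p.K).comp (MonoidHom.snd G G))))
    ((p.P.subtype.comp x.1.1.toMonoidHom).prod p.P.subtype).range
    (by
      rintro _ ⟨y, rfl⟩
      exact x.2.1 y)
    (by
      rintro ⟨g, h⟩ ht _ ⟨y, rfl⟩
      have ht : (QuotientGroup.mk g : G ⧸ p.K) = x.1.2 (QuotientGroup.mk h) := ht
      refine ⟨p.crossed.act (QuotientGroup.mk h) y, Prod.ext ?_ (coe_crossed_act h y)⟩
      change ((x.1.1 (p.crossed.act (QuotientGroup.mk h) y) : p.P) : G) = g * x.1.1 y * g⁻¹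
      rw [x.2.2, ← ht, coe_crossed_act])

theorem mem_autSection_T {x : p.crossed.aut} {z : G × G} :
    z ∈ (autSection x).T ↔ (QuotientGroup.mk z.1 : G ⧸ p.K) = x.1.2 (QuotientGroup.mk z.2) :=
  Iff.rfl

theorem mem_autSection_S {x : p.crossed.aut} {z : G × G} :
    z ∈ (autSection x).S ↔ ∃ y : p.P, (x.1.1 y : G) = z.1 ∧ (y : G) = z.2 :=
  exists_congr fun _ => Prod.ext_iff

theorem autSection_hasInvariants (x : p.crossed.aut) : HasInvariants p p (autSection x) := by
  rw [hasInvariants_iff]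
  constructor
  · refine ⟨fun g => ?_, fun g => ?_, fun g => ?_, fun g hg => ?_⟩
    · obtain ⟨h, hh⟩ := QuotientGroup.mk_surjective (x.1.2.symm (QuotientGroup.mk g))
      exact ⟨h, mem_autSection_T.2 (by rw [hh, MulEquiv.apply_symm_apply])⟩
    · rw [mem_autSection_T, QuotientGroup.mk_one, map_one, QuotientGroup.eq_one_iff]
    · simp only [mem_autSection_S]
      constructor
      · rintro ⟨_, y, rfl, _⟩
        exact (x.1.1 y).2
      · exact fun hg => ⟨_, x.1.1.symm ⟨g, hg⟩, by rw [MulEquiv.apply_symm_apply], rfl⟩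
    · obtain ⟨y, rfl, hy⟩ := mem_autSection_S.1 hg
      obtain rfl : y = 1 := Subtype.ext hy
      simp
  · refine ⟨fun h => ?_, fun h => ?_, fun h => ?_, fun h hh => ?_⟩
    · obtain ⟨g, hg⟩ := QuotientGroup.mk_surjective (x.1.2 (QuotientGroup.mk h))
      exact ⟨g, GroupSection.mem_swap_T.2 (mem_autSection_T.2 hg)⟩
    · rw [GroupSection.mem_swap_T, mem_autSection_T, QuotientGroup.mk_one, eq_comm,
        map_eq_one_iff _ x.1.2.injective, QuotientGroup.eq_one_iff]
    · simp only [GroupSection.mem_swap_S, mem_autSection_S]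
      constructor
      · rintro ⟨_, y, _, rfl⟩
        exact y.2
      · exact fun hh => ⟨_, ⟨h, hh⟩, rfl, rfl⟩
    · obtain ⟨y, hy, rfl⟩ := mem_autSection_S.1 (GroupSection.mem_swap_S.1 hh)
      have h1 : x.1.1 y = 1 := Subtype.ext hy
      rw [map_eq_one_iff _ x.1.1.injective] at h1
      rw [h1]
      rfl

theorem autSection_mul (x y : p.crossed.aut) :
    autSection (x * y) = (autSection x).comp (autSection y) := by
  ext ⟨a, b⟩
  · rw [GroupSection.mem_comp_T]
    simp only [mem_autSection_T]
    constructor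
    · intro h
      obtain ⟨c, hc⟩ := QuotientGroup.mk_surjective (y.1.2 (QuotientGroup.mk b))
      exact ⟨c, by rw [hc]; exact h, hc⟩
    · rintro ⟨c, h1, h2⟩
      rw [h2] at h1
      exact h1
  · rw [GroupSection.mem_comp_S]
    simp only [mem_autSection_S]
    constructor
    · rintro ⟨z, hz, h⟩
      exact ⟨_, ⟨y.1.1 z, hz, rfl⟩, z, rfl, h⟩
    · rintro ⟨_, ⟨z, h1, rfl⟩, z', h2, h3⟩
      obtain rfl : y.1.1 z' = z := Subtype.ext h2
      exact ⟨z', h1, h3⟩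

/-- Two surjections with the same kernel have isomorphic targets, compatibly. -/
theorem _root_.MonoidHom.exists_mulEquiv_of_ker_eq {T A B : Type*} [Group T] [Group A] [Group B]
    (f : T →* A) (f' : T →* B) (hf : Function.Surjective f) (hf' : Function.Surjective f')
    (h : f'.ker = f.ker) : ∃ e : B ≃* A, ∀ t, e (f' t) = f t := by
  let e₁ := QuotientGroup.quotientKerEquivOfSurjective f hf
  let e₂ := QuotientGroup.quotientKerEquivOfSurjective f' hf'
  refine ⟨(e₂.symm.trans (QuotientGroup.quotientMulEquivOfEq h)).trans e₁, fun t => ?_⟩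
  have ht : e₂.symm (f' t) = QuotientGroup.mk t := by
    rw [MulEquiv.symm_apply_eq]
    rfl
  simp only [MulEquiv.trans_apply, ht]
  rfl

/-- Every section with the right invariants consists of the graphs of an automorphism: this is
Goursat's lemma applied to `T` and to `S`. -/
theorem exists_autSection_eq {s : GroupSection (G × G)} (hs : HasInvariants p p s) :
    ∃ x : p.crossed.aut, autSection x = s := by
  obtain ⟨h₁, h₂⟩ := hasInvariants_iff.1 hs
  obtain ⟨β, hβ⟩ := MonoidHom.exists_mulEquiv_of_ker_eq
    ((QuotientGroup.mk' p.K).comp ((MonoidHom.fst G G).comp s.T.subtype))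
    ((QuotientGroup.mk' p.K).comp ((MonoidHom.snd G G).comp s.T.subtype))
    (fun z => by
      obtain ⟨g, rfl⟩ := QuotientGroup.mk_surjective z
      obtain ⟨h, hh⟩ := h₁.exists_T g
      exact ⟨⟨(g, h), hh⟩, rfl⟩)
    (fun z => by
      obtain ⟨h, rfl⟩ := QuotientGroup.mk_surjective z
      obtain ⟨g, hg⟩ := h₂.exists_T h
      exact ⟨⟨(g, h), hg⟩, rfl⟩)
    (by
      ext ⟨⟨g, h⟩, ht⟩
      refine (QuotientGroup.eq_one_iff h).trans (Iff.trans ?_ (QuotientGroup.eq_one_iff g).symm)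
      rw [← h₁.mem_T_one g, ← h₂.mem_T_one h, GroupSection.mem_swap_T]
      constructor
      · intro h
        simpa using s.T.mul_mem ht (s.T.inv_mem h)
      · intro h
        simpa using s.T.mul_mem ht (s.T.inv_mem h))
  obtain ⟨α, hα⟩ := MonoidHom.exists_mulEquiv_of_ker_eq
    (((MonoidHom.fst G G).comp s.S.subtype).codRestrict p.P
      fun z => (h₁.exists_S z.1.1).1 ⟨z.1.2, z.2⟩)
    (((MonoidHom.snd G G).comp s.S.subtype).codRestrict p.P
      fun z => (h₂.exists_S z.1.2).1 ⟨z.1.1, z.2⟩)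
    (fun ⟨g, hg⟩ => by
      obtain ⟨h, hh⟩ := (h₁.exists_S g).2 hg
      exact ⟨⟨(g, h), hh⟩, rfl⟩)
    (fun ⟨h, hh⟩ => by
      obtain ⟨g, hg⟩ := (h₂.exists_S h).2 hh
      exact ⟨⟨(g, h), hg⟩, rfl⟩)
    (by
      ext ⟨⟨g, h⟩, ht⟩
      refine Subtype.ext_iff.trans (Iff.trans ?_ Subtype.ext_iff.symm)
      change h = 1 ↔ g = 1
      constructor
      · rintro rfl
        exact h₁.eq_one g ht
      · rintro rfl
        exact h₂.eq_one h ht)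
  have hβ : ∀ g h, (g, h) ∈ s.T → β (QuotientGroup.mk h) = QuotientGroup.mk g :=
    fun g h ht => hβ ⟨(g, h), ht⟩
  have hα : ∀ a b (ha : a ∈ p.P) (hb : b ∈ p.P), (a, b) ∈ s.S → α ⟨b, hb⟩ = ⟨a, ha⟩ :=
    fun a b _ _ ht => hα ⟨(a, b), ht⟩
  have exS : ∀ y : p.P, ∃ a : p.P, ((a : G), (y : G)) ∈ s.S := fun y => by
    obtain ⟨a, ha⟩ := (h₂.exists_S y).2 y.2
    exact ⟨⟨a, (h₁.exists_S a).1 ⟨y, ha⟩⟩, ha⟩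
  refine ⟨⟨(α, β), fun y => ?_, fun z y => ?_⟩, ?_⟩
  · obtain ⟨a, ha⟩ := exS y
    rw [crossed_bd, crossed_bd, hβ _ _ (s.le ha)]
    dsimp only
    rw [hα a y a.2 y.2 ha]
  · obtain ⟨h, rfl⟩ := QuotientGroup.mk_surjective z
    obtain ⟨g, hg⟩ := h₂.exists_T h
    have hg : (g, h) ∈ s.T := hg
    obtain ⟨a, ha⟩ := exS y
    dsimp only
    rw [hβ g h hg, hα a y a.2 y.2 ha]
    refine hα _ _ (p.crossed.act (QuotientGroup.mk g) a).2
      (p.crossed.act (QuotientGroup.mk h) y).2 ?_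
    rw [coe_crossed_act, coe_crossed_act]
    exact s.conj_mem hg ha
  · ext ⟨g, h⟩
    · rw [mem_autSection_T]
      constructor
      · intro e
        obtain ⟨g', hg'⟩ := h₂.exists_T h
        have hg' : (g', h) ∈ s.T := hg'
        have e : (QuotientGroup.mk g : G ⧸ p.K) = β (QuotientGroup.mk h) := e
        rw [hβ g' h hg', eq_comm, QuotientGroup.eq, ← h₁.mem_T_one] at e
        simpa using s.T.mul_mem hg' e
      · exact fun ht => (hβ g h ht).symm
    · rw [mem_autSection_S]
      constructor
      · rintro ⟨y, rfl, rfl⟩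
        obtain ⟨a, ha⟩ := exS y
        dsimp only
        rwa [hα a y a.2 y.2 ha]
      · intro hS
        have hg := (h₁.exists_S g).1 ⟨h, hS⟩
        have hh := (h₂.exists_S h).1 ⟨g, hS⟩
        exact ⟨⟨h, hh⟩, congrArg Subtype.val (hα g h hg hh hS), rfl⟩

end CommPair

theorem GroupSection.cls_eq_of_conj [Finite G] {s s' : GroupSection G} (g : G)
    (hT : ∀ x, g⁻¹ * x * g ∈ s'.T ↔ x ∈ s.T) (hS : ∀ x, g⁻¹ * x * g ∈ s'.S ↔ x ∈ s.S) :
    s.cls = s'.cls := by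
  have trans : ∀ (U : Subgroup G) (y : G ⧸ U), ∃ a : G, a • (QuotientGroup.mk g : G ⧸ U) = y := by
    rintro U ⟨a⟩
    exact ⟨a * g⁻¹, congrArg QuotientGroup.mk (inv_mul_cancel_right a g)⟩
  refine Subtype.ext (sliceClass_eq_of_iso (proj_iso s s'.proj
    (show G ⧸ s'.S from QuotientGroup.mk g) (fun x => ?_) (fun x => ?_) (trans s'.S) (trans s'.T)))
  · rw [← hS, mul_assoc]
    exact smul_mk_eq_mk_iff
  · rw [← hT, mul_assoc]
    exact smul_mk_eq_mk_iff

attribute [local instance] Gam.instMul Gam.group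

variable (k : Type w) [Field k] [CharZero k] [Finite G]

namespace CommPair

variable (p) in
/-- The homomorphism `Aut(P, G/K, i_P) → Γ_{(G,K,P)}` given by graphs. -/
def autHom : p.crossed.aut →* Gam k p :=
  MonoidHom.mk' (fun x => Gam.mk k (autSection x) (autSection_hasInvariants x)) fun x y => by
    rw [Gam.mk_mul_mk]
    exact Gam.mk_congr (autSection_mul x y)

theorem autHom_surjective : Function.Surjective (p.autHom k) := fun a => by
  obtain ⟨s, hs, rfl⟩ := Gam.exists_mk a
  obtain ⟨x, hx⟩ := exists_autSection_eq hs
  subst hx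
  exact ⟨x, rfl⟩

/-- The graphs of an automorphism are conjugate to the diagonal section by `(g, h)` exactly when the
automorphism is the inner automorphism given by `g h⁻¹`. -/
theorem ker_autHom : (p.autHom k).ker = p.crossed.inn := by
  ext x
  rw [MonoidHom.mem_ker]
  constructor
  · intro hx
    obtain ⟨⟨g, h⟩, hS, hT⟩ := exists_conj_of_tmul_cls_eq
      (inv_ne_zero (p.index_ne_zero (k := k))) (congrArg Subtype.val hx)
    refine ⟨QuotientGroup.mk (g * h⁻¹), Subtype.ext (Prod.ext (MulEquiv.ext fun y => Subtype.ext ?_)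
      (MulEquiv.ext fun z => ?_))⟩
    · have h1 := (mem_diagSection_S.1 (hS ((x.1.1 y : G), (y : G))
        (mem_autSection_S.2 ⟨y, rfl, rfl⟩))).1
      have h1 : g⁻¹ * x.1.1 y * g = h⁻¹ * y * h := h1
      refine (coe_crossed_act (g * h⁻¹) y).trans ?_
      calc g * h⁻¹ * y * (g * h⁻¹)⁻¹ = g * (h⁻¹ * y * h) * g⁻¹ := by group
        _ = x.1.1 y := by rw [← h1]; group
    · obtain ⟨b, rfl⟩ := QuotientGroup.mk_surjective z
      obtain ⟨a, ha⟩ := QuotientGroup.mk_surjective (x.1.2 (QuotientGroup.mk b))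
      have h1 := mem_diagSection_T.1 (hT (a, b) (mem_autSection_T.2 ha))
      have h1 : (h⁻¹ * b * h)⁻¹ * (g⁻¹ * a * g) ∈ p.K := h1
      rw [← QuotientGroup.eq] at h1
      have h2 : (QuotientGroup.mk (g * h⁻¹ * b * (g * h⁻¹)⁻¹) : G ⧸ p.K) = QuotientGroup.mk a := by
        calc (QuotientGroup.mk (g * h⁻¹ * b * (g * h⁻¹)⁻¹) : G ⧸ p.K)
            = QuotientGroup.mk g * QuotientGroup.mk (h⁻¹ * b * h) * (QuotientGroup.mk g)⁻¹ := by
              rw [← QuotientGroup.mk_inv, ← QuotientGroup.mk_mul, ← QuotientGroup.mk_mul]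
              congr 1
              group
          _ = QuotientGroup.mk a := by
              rw [h1, ← QuotientGroup.mk_inv, ← QuotientGroup.mk_mul, ← QuotientGroup.mk_mul]
              congr 1
              group
      exact h2.trans ha
  · rintro ⟨z, rfl⟩
    obtain ⟨g, rfl⟩ := QuotientGroup.mk_surjective z
    refine Subtype.ext (congrArg ((p.P.index : k)⁻¹ ⊗ₜ[ℤ] ·)
      (GroupSection.cls_eq_of_conj (g, 1) ?_ ?_))
    · rintro ⟨a, b⟩
      rw [mem_diagSection_T, mem_autSection_T, ← QuotientGroup.eq]
      change (QuotientGroup.mk (1⁻¹ * b * 1) : G ⧸ p.K) = QuotientGroup.mk (g⁻¹ * a * g) ↔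
        (QuotientGroup.mk a : G ⧸ p.K) =
          QuotientGroup.mk g * QuotientGroup.mk b * (QuotientGroup.mk g)⁻¹
      rw [inv_one, one_mul, mul_one, QuotientGroup.mk_mul, QuotientGroup.mk_mul,
        QuotientGroup.mk_inv, mul_assoc (QuotientGroup.mk g)⁻¹, eq_inv_mul_iff_mul_eq,
        eq_mul_inv_iff_mul_eq, eq_comm]
    · rintro ⟨a, b⟩
      rw [mem_diagSection_S, mem_autSection_S]
      change g⁻¹ * a * g = 1⁻¹ * b * 1 ∧ g⁻¹ * a * g ∈ p.P ↔
        ∃ y : p.P, ((p.crossed.act (QuotientGroup.mk g) y : p.P) : G) = a ∧ (y : G) = b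
      simp only [coe_crossed_act]
      constructor
      · rintro ⟨e, hP⟩
        refine ⟨⟨_, hP⟩, by dsimp only; group, ?_⟩
        simpa using e
      · rintro ⟨y, rfl, rfl⟩
        have e : g⁻¹ * (g * y * g⁻¹) * g = y := by group
        rw [e]
        exact ⟨by group, y.2⟩

variable (p) in
/-- The isomorphism `Γ_{(G,K,P)} ≃ Out(P, G/K, i_P)`. -/
def gamEquivOut : Gam k p ≃* p.crossed.Out :=
  ((QuotientGroup.quotientMulEquivOfEq (ker_autHom k)).symm.trans
    (QuotientGroup.quotientKerEquivOfSurjective (p.autHom k) (autHom_surjective k))).symm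

end CommPair

end OuterAut

end SectionBiset

end

theorem mainTheorem4 (k : Type w) [Field k] [CharZero k] (G H : Type u) [Group G] [Finite G]
    [Group H] [Finite H] (p : CommPair G) (q : CommPair H) (hpq : Linked p q) :
    ∃ (_ : Group (Gam k p)) (_ : Group (Gam k q)) (_ : MulAction (Gam k p) (GamBi k p q))
      (_ : MulAction (Gam k q)ᵐᵒᵖ (GamBi k p q))
      (_ : SMulCommClass (Gam k p) (Gam k q)ᵐᵒᵖ (GamBi k p q)),
      -- (a) for both pairs
      (Finite (Gam k p) ∧
        (∀ a b : Gam k p, ((a * b : Gam k p) : LinHom k G G) = linComp a.1 b.1) ∧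
        ((1 : Gam k p) : LinHom k G G) = idem k p ∧
        ∀ a : Gam k p, ((a⁻¹ : Gam k p) : LinHom k G G) = linOpp a.1) ∧
      (Finite (Gam k q) ∧
        (∀ a b : Gam k q, ((a * b : Gam k q) : LinHom k H H) = linComp a.1 b.1) ∧
        ((1 : Gam k q) : LinHom k H H) = idem k q ∧
        ∀ a : Gam k q, ((a⁻¹ : Gam k q) : LinHom k H H) = linOpp a.1) ∧
      -- (b)
      (∀ (a : Gam k p) (x : GamBi k p q),
        ((a • x : GamBi k p q) : LinHom k G H) = linComp a.1 x.1) ∧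
      (∀ (b : Gam k q) (x : GamBi k p q),
        ((MulOpposite.op b • x : GamBi k p q) : LinHom k G H) = linComp x.1 b.1) ∧
      Nonempty (GamBi k p q) ∧
      MulAction.IsPretransitive (Gam k p) (GamBi k p q) ∧
      MulAction.IsPretransitive (Gam k q)ᵐᵒᵖ (GamBi k p q) ∧
      (∀ (a : Gam k p) (x : GamBi k p q), a • x = x → a = 1) ∧
      (∀ (b : Gam k q) (x : GamBi k p q), MulOpposite.op b • x = x → b = 1) ∧
      -- (c)
      (∀ x : GamBi k p q, ∃! φ : Gam k q ≃* Gam k p,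
        ∀ b : Gam k q, φ b • x = MulOpposite.op b • x) ∧
      -- (d)
      (bisetFunctor k (Gam k p) (Gam k q) (GamBi k p q)).IsEquivalence ∧
      (∀ M : ModuleCat.{max w (u + 1)} (MonoidAlgebra k (Gam k q)),
        Module.Finite (MonoidAlgebra k (Gam k p))
            ((bisetFunctor k (Gam k p) (Gam k q) (GamBi k p q)).obj M) ↔
          Module.Finite (MonoidAlgebra k (Gam k q)) M) ∧
      (∃ Φ : Irr.{max w (u + 1), max w (u + 1)} (MonoidAlgebra k (Gam k q)) ≃
          Irr.{max w (u + 1), max w (u + 1)} (MonoidAlgebra k (Gam k p)),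
        ∀ (M : ModuleCat.{max w (u + 1)} (MonoidAlgebra k (Gam k q)))
          (hM : IsSimpleModule (MonoidAlgebra k (Gam k q)) M),
          ∃ hF : IsSimpleModule (MonoidAlgebra k (Gam k p))
              ((bisetFunctor k (Gam k p) (Gam k q) (GamBi k p q)).obj M),
            Φ (Irr.mk M hM) =
              Irr.mk ((bisetFunctor k (Gam k p) (Gam k q) (GamBi k p q)).obj M) hF) ∧
      -- (e)
      Nonempty (Gam k p ≃* p.crossed.Out) := by
  let _ := Gam.group (k := k) (p := p)
  let _ := Gam.group (k := k) (p := q)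
  let _ := GamBi.leftAction (k := k) (p := p) (q := q)
  let _ := GamBi.rightAction (k := k) (p := p) (q := q)
  have hcomm : SMulCommClass (Gam k p) (Gam k q)ᵐᵒᵖ (GamBi k p q) := GamBi.smulCommClass
  have hX : IsBitorsor (Gam k p) (Gam k q) (GamBi k p q) := isBitorsor_gamBi hpq
  have hF := hX.isEquivalence_bisetFunctor k
  exact ⟨Gam.group, Gam.group, GamBi.leftAction, GamBi.rightAction, hcomm,
    ⟨inferInstance, fun _ _ => rfl, rfl, fun _ => rfl⟩,
    ⟨inferInstance, fun _ _ => rfl, rfl, fun _ => rfl⟩, fun _ _ => rfl, fun _ _ => rfl,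
    hX.nonempty, hX.left_trans, hX.right_trans, hX.left_free, hX.right_free,
    hX.existsUnique_mulEquiv, hF, hX.finite_bisetFunctor_iff k,
    exists_irr_equiv _ (hX.isSimpleModule_bisetFunctor_iff k), ⟨p.gamEquivOut k⟩⟩
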